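/- Let $H$ be a separable complex Hilbert space with $\dim H\ge 3$, and let $\mathcal B_s(H)$ be the set of all bounded self-adjoint operators on $H$. For a bounded operator $A$ on $H$ let $w(A)=\sup\{|\langle Ax,x\rangle| : x\in H,\ \|x\|=1\}$ be its numerical radius. Fix an arbitrary orthonormal basis $(e_i)$ of $H$ and let $T^t$ denote the transpose of $T$ with respect to it, that is, the bounded operator with $\langle T^t e_j,e_i\rangle=\langle Te_i,e_j\rangle$ for all $i,j$. Let $\Phi:\mathcal B_s(H)\to\mathcal B_s(H)$ be a surjective map (not assumed linear or continuous). Then $$w(AB-BA)=w\big(\Phi(A)\Phi(B)-\Phi(B)\Phi(A)\big)\quad\text{for all }A,B\in\mathcal B_s(H)$$ if and only if there exist a unitary operator $U$ on $H$, a function $h:\mathcal B_s(H)\to\{1,-1\}$ and a function $f:\mathcal B_s(H)\to\mathbb R$ such that either $$\Phi(T)=h(T)\,UTU^*+f(T)I\quad\text{for all }T\in\mathcal B_s(H),$$ or $$\Phi(T)=h(T)\,UT^tU^*+f(T)I\quad\text{for all }T\in\mathcal B_s(H).$$ -/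

import Mathlib

open scoped InnerProductSpace

noncomputable section

namespace LieNumRadius

/-- The numerical range `W(A) = {⟨Ax, x⟩ : ‖x‖ = 1}`. Mathlib's inner product is linear in its
second argument, so `⟨Ax, x⟩`, for an inner product linear in the first one, is `⟪x, A x⟫_ℂ`. -/
def numericalRange {H : Type*} [NormedAddCommGroup H] [InnerProductSpace ℂ H]
    (A : H →L[ℂ] H) : Set ℂ :=
  {z | ∃ x : H, ‖x‖ = 1 ∧ ⟪x, A x⟫_ℂ = z}

/-- The numerical radius `w(A) = sup {|z| : z ∈ W(A)}`. -/
def numericalRadius {H : Type*} [NormedAddCommGroup H] [InnerProductSpace ℂ H]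
    (A : H →L[ℂ] H) : ℝ :=
  sSup ((fun z : ℂ => ‖z‖) '' numericalRange A)

/-- The conjugation `∑ cᵢ eᵢ ↦ ∑ (conj cᵢ) eᵢ` of `H` given by an orthonormal basis `(eᵢ)`:
pass to coordinates in `ℓ²(ι)`, conjugate them, and go back. -/
def basisConj {H : Type*} [NormedAddCommGroup H] [InnerProductSpace ℂ H] {ι : Type*}
    (b : HilbertBasis ι ℂ H) : H ≃ₗᵢ⋆[ℂ] H :=
  (b.repr.trans (starₗᵢ ℂ)).trans b.repr.symm

/-- The transpose `Tᵗ` of `T` with respect to an orthonormal basis: the operator `J T* J`, with `J`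
the conjugation given by the basis. In that basis its matrix is the transpose of the matrix of `T`
(`inner_basisTranspose` below). -/
def basisTranspose {H : Type*} [NormedAddCommGroup H] [InnerProductSpace ℂ H] [CompleteSpace H]
    {ι : Type*} (b : HilbertBasis ι ℂ H) (T : H →L[ℂ] H) : H →L[ℂ] H :=
  (basisConj b).toLinearIsometry.toContinuousLinearMap.comp
    ((ContinuousLinearMap.adjoint T).comp (basisConj b).toLinearIsometry.toContinuousLinearMap)

theorem basisConj_basis {H : Type*} [NormedAddCommGroup H] [InnerProductSpace ℂ H] {ι : Type*}
    (b : HilbertBasis ι ℂ H) (i : ι) : basisConj b (b i) = b i := by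
  classical
  have h : star (b.repr (b i)) = b.repr (b i) := by
    ext j
    rw [lp.star_apply, b.repr_self, lp.single_apply]
    by_cases hj : j = i
    · subst hj; simp
    · simp [hj]
  simp [basisConj, h]

theorem inner_basisConj {H : Type*} [NormedAddCommGroup H] [InnerProductSpace ℂ H] {ι : Type*}
    (b : HilbertBasis ι ℂ H) (x y : H) :
    ⟪basisConj b x, basisConj b y⟫_ℂ = ⟪y, x⟫_ℂ := by
  rw [← b.repr.inner_map_map (basisConj b x), ← b.repr.inner_map_map y, lp.inner_eq_tsum,
    lp.inner_eq_tsum]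
  refine tsum_congr fun i => ?_
  simp [basisConj, mul_comm]

theorem inner_basisTranspose {H : Type*} [NormedAddCommGroup H] [InnerProductSpace ℂ H]
    [CompleteSpace H] {ι : Type*} (b : HilbertBasis ι ℂ H) (T : H →L[ℂ] H) (i j : ι) :
    ⟪b i, basisTranspose b T (b j)⟫_ℂ = ⟪b j, T (b i)⟫_ℂ := by
  have h : basisTranspose b T (b j) = basisConj b (ContinuousLinearMap.adjoint T (b j)) := by
    simp [basisTranspose, basisConj_basis]
  rw [h, ← basisConj_basis b i, inner_basisConj, ContinuousLinearMap.adjoint_inner_left,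
    basisConj_basis]

end LieNumRadius

end

open scoped InnerProductSpace

noncomputable section

/-! A commutator does not see scalar summands, and `w` does not see signs; the content is that
nothing else is lost. Since `w(T) = 0` forces `T = 0` (`numericalRadius_eq_zero_iff`), `Φ` preserves
commutation in both directions. Being surjective, it then preserves and reflects every property
phrased through commutants, even without injectivity. One such property, `IsAtomic`, singles out the
operators `aP + bI` with `a ≠ 0` and `P` a projection of rank or corank one (`isAtomic_rankOneSelf`,
`IsAtomic.exists_rankOneSelf`). Hence `Φ` induces a surjective map of lines that preserves
orthogonality in both directions, and Uhlhorn's theorem (`IsOrthoMap.exists_semilinear`) provides a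
unitary or antiunitary `S` inducing it.

Commutation alone does not pin down `Φ A`; the values of `w` do. For the rank one operator `x ⊗ x`,
the number `w([A, x ⊗ x])²` is the variance `‖Ax‖²‖x‖² - ⟨Ax, x⟩²`
(`numericalRadius_commutator_rankOneSelf`). Testing against rank one operators shows that `A` at `x`
and `Φ A` at `S x` have the same variance, up to a factor depending only on `x`. That factor is 1,
by comparison of three vectors that are pairwise neither orthogonal nor parallel
(`exists_semilinear_variance`). Finally, the variances determine a self-adjoint operator up to sign
and a real scalar (`eq_smul_add_of_variance`).

For linear `S` this gives the form with `T`. For antilinear `S`, composing with the conjugation of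
the basis gives a unitary and turns `T` into its transpose. Conversely, unitary conjugation
preserves `w`, and transposition only reverses commutators. -/

namespace LieNumRadius


/-! ### Maps preserving the inner product values 0 and -1 -/

section Chart

variable {E F : Type*} [NormedAddCommGroup E] [InnerProductSpace ℂ E]
  [NormedAddCommGroup F] [InnerProductSpace ℂ F]

/-- A vector orthogonal to everything that is orthogonal to `a` is a multiple of `a`. -/
theorem exists_smul_of_orthogonal {a b : E}
    (h : ∀ z : E, z ≠ 0 → ⟪a, z⟫_ℂ = 0 → ⟪b, z⟫_ℂ = 0) : ∃ c : ℂ, b = c • a := by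
  refine ⟨⟪a, b⟫_ℂ / ⟪a, a⟫_ℂ, ?_⟩
  by_contra hne
  have hz : b - (⟪a, b⟫_ℂ / ⟪a, a⟫_ℂ) • a ≠ 0 := sub_ne_zero.mpr hne
  have haz : ⟪a, b - (⟪a, b⟫_ℂ / ⟪a, a⟫_ℂ) • a⟫_ℂ = 0 := by
    rw [inner_sub_right, inner_smul_right]
    by_cases ha : a = 0
    · simp [ha]
    · rw [div_mul_cancel₀ _ (inner_self_ne_zero.mpr ha), sub_self]
  apply hz
  rw [← inner_self_eq_zero (𝕜 := ℂ)]
  conv_lhs => rw [inner_sub_left, inner_smul_left]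
  rw [haz, h _ hz haz, mul_zero, sub_zero]

/-- A surjection that preserves the relations `⟪x, y⟫ = 0` and `⟪x, y⟫ = -1` in both
directions. -/
structure IsChart (S : E → F) : Prop where
  surj : Function.Surjective S
  orth : ∀ x y, ⟪x, y⟫_ℂ = 0 ↔ ⟪S x, S y⟫_ℂ = 0
  neg_one : ∀ x y, ⟪x, y⟫_ℂ = -1 ↔ ⟪S x, S y⟫_ℂ = -1

namespace IsChart

variable {S : E → F} (hS : IsChart S)
include hS

theorem map_zero : S 0 = 0 := by
  rw [← inner_self_eq_zero (𝕜 := ℂ), ← hS.orth, inner_zero_left]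

theorem eq_zero_iff {x : E} : S x = 0 ↔ x = 0 := by
  rw [← inner_self_eq_zero (𝕜 := ℂ), ← hS.orth, inner_self_eq_zero]

theorem parallel {x y : E} : (∃ c : ℂ, y = c • x) ↔ ∃ c : ℂ, S y = c • S x := by
  constructor
  · rintro ⟨c, rfl⟩
    refine exists_smul_of_orthogonal fun z' _ hz => ?_
    obtain ⟨z, rfl⟩ := hS.surj z'
    rw [← hS.orth] at hz ⊢
    rw [inner_smul_left, hz, mul_zero]
  · rintro ⟨c, hc⟩
    refine exists_smul_of_orthogonal fun z _ hz => ?_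
    rw [hS.orth] at hz ⊢
    rw [hc, inner_smul_left, hz, mul_zero]

/-- If `w` is orthogonal to `y`, then `x` and `x + y` have the same inner product with `w`. When it
is nonzero, rescaling `w` makes it -1, a value that `S` preserves. So `S (x + y) - S x` is
orthogonal to everything orthogonal to `S y`. -/
theorem map_add_sub (x y : E) : ∃ c : ℂ, S (x + y) - S x = c • S y := by
  refine exists_smul_of_orthogonal fun w' _ hw => ?_
  obtain ⟨w, rfl⟩ := hS.surj w'
  have hyw : ⟪y, w⟫_ℂ = 0 := (hS.orth _ _).mpr hw
  rw [inner_sub_left]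
  by_cases ha : ⟪x, w⟫_ℂ = 0
  · rw [(hS.orth _ _).mp ha, (hS.orth (x + y) w).mp (by rw [inner_add_left, ha, hyw, add_zero]),
      sub_zero]
  · obtain ⟨c, hc⟩ := hS.parallel.mp ⟨-(⟪x, w⟫_ℂ)⁻¹, rfl⟩
    have h1 : ⟪x, -(⟪x, w⟫_ℂ)⁻¹ • w⟫_ℂ = -1 := by
      rw [inner_smul_right, neg_mul, inv_mul_cancel₀ ha]
    have h2 : ⟪x + y, -(⟪x, w⟫_ℂ)⁻¹ • w⟫_ℂ = -1 := by
      rw [inner_add_left, h1, inner_smul_right, hyw, mul_zero, add_zero]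
    rw [hS.neg_one, hc, inner_smul_right] at h1 h2
    have hc0 : c ≠ 0 := by rintro rfl; simp at h1
    exact mul_left_cancel₀ hc0 (by rw [mul_sub, h1, h2]; simp)

theorem map_add_of_not_parallel {x y : E} (h : ¬ ∃ c : ℂ, y = c • x) :
    S (x + y) = S x + S y := by
  obtain ⟨a, ha⟩ := hS.map_add_sub x y
  obtain ⟨b, hb⟩ := hS.map_add_sub y x
  rw [add_comm y x] at hb
  have hab : (1 - a) • S y = (1 - b) • S x := by
    rw [sub_smul, sub_smul, ← ha, ← hb, one_smul, one_smul]; abel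
  by_cases h1 : 1 - a = 0
  · rw [sub_eq_zero] at h1
    rw [← h1, one_smul] at ha
    rw [← ha]; abel
  · refine absurd (hS.parallel.mpr ⟨(1 - a)⁻¹ * (1 - b), ?_⟩) h
    rw [mul_smul, ← hab, smul_smul, inv_mul_cancel₀ h1, one_smul]

variable (hdim : ∀ a : E, ∃ c : E, c ≠ 0 ∧ ⟪a, c⟫_ℂ = 0)
include hdim

theorem map_add (x y : E) : S (x + y) = S x + S y := by
  by_cases h : ∃ c : ℂ, y = c • x
  · by_cases hx : x = 0
    · obtain ⟨c, rfl⟩ := h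
      simp [hx, hS.map_zero]
    obtain ⟨c, rfl⟩ := h
    -- Parallel vectors are separated by an auxiliary `z` orthogonal to both: the image of `x + c •
    -- x + z` is computed in two ways, using additivity only for independent pairs.
    obtain ⟨z, hz, hxz⟩ := hdim x
    have key : ∀ d : ℂ, S (d • x + z) = S (d • x) + S z := fun d => by
      refine hS.map_add_of_not_parallel ?_
      rintro ⟨k, hk⟩
      apply hz
      rw [← inner_self_eq_zero (𝕜 := ℂ)]
      nth_rw 1 [hk]
      simp [inner_smul_left, hxz]
    have h1 : S (x + (c • x + z)) = S x + S (c • x + z) := by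
      refine hS.map_add_of_not_parallel ?_
      rintro ⟨k, hk⟩
      have : z = (k - c) • x := by rw [sub_smul, ← hk]; simp
      apply hz
      rw [← inner_self_eq_zero (𝕜 := ℂ)]
      nth_rw 1 [this]
      simp [inner_smul_left, hxz]
    have h2 : x + (c • x + z) = (1 + c) • x + z := by rw [add_smul, one_smul]; abel
    rw [h2, key, key, ← add_assoc, add_left_inj, add_smul, one_smul] at h1
    exact h1
  · exact hS.map_add_of_not_parallel h

/-- Each line comes with its own scalar function `τ x`. Additivity makes these agree for independent
vectors, and two parallel vectors are compared through a third one. -/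
theorem exists_smul : ∃ σ : ℂ → ℂ, ∀ (c : ℂ) (x : E), S (c • x) = σ c • S x := by
  have h0 : ∀ (x : E) (c : ℂ), ∃ d : ℂ, S (c • x) = d • S x :=
    fun x c => hS.parallel.mp ⟨c, rfl⟩
  choose τ hτ using h0
  obtain ⟨u, hu, -⟩ := hdim 0
  obtain ⟨v, hv, huv⟩ := hdim u
  have huv' : ¬ ∃ c : ℂ, v = c • u := by
    rintro ⟨k, hk⟩
    apply hv
    rw [← inner_self_eq_zero (𝕜 := ℂ)]
    nth_rw 1 [hk]
    simp [inner_smul_left, huv]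
  have key : ∀ (x y : E) (c : ℂ), x ≠ 0 → (¬ ∃ k : ℂ, y = k • x) → τ x c = τ y c := by
    intro x y c hx hxy
    have h1 := hτ (x + y) c
    rw [smul_add, hS.map_add hdim, hS.map_add hdim, hτ, hτ, smul_add] at h1
    have h2 : (τ x c - τ (x + y) c) • S x = (τ (x + y) c - τ y c) • S y := by
      rw [sub_smul, sub_smul, sub_eq_sub_iff_add_eq_add, h1]; abel
    by_cases h3 : τ (x + y) c - τ y c = 0
    · rw [h3, zero_smul, smul_eq_zero, or_iff_left (mt hS.eq_zero_iff.mp hx)] at h2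
      rw [sub_eq_zero.mp h2, sub_eq_zero.mp h3]
    · refine absurd (hS.parallel.mpr ⟨(τ (x + y) c - τ y c)⁻¹ * (τ x c - τ (x + y) c), ?_⟩) hxy
      rw [mul_smul, h2, smul_smul, inv_mul_cancel₀ h3, one_smul]
  refine ⟨τ u, fun c x => ?_⟩
  rw [hτ]
  by_cases hx : x = 0
  · simp [hx, hS.map_zero]
  congr 1
  by_cases hxu : ∃ k : ℂ, x = k • u
  · rw [key u v c hu huv']
    refine key x v c hx ?_
    rintro ⟨k, rfl⟩
    obtain ⟨l, rfl⟩ := hxu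
    exact huv' ⟨k * l, by rw [mul_smul]⟩
  · exact (key u x c hu hxu).symm

/-- A chart is semilinear for the identity or the complex conjugation, and it preserves inner
products up to this automorphism. -/
theorem exists_semilinear : ∃ σ : ℂ →+* ℂ, (σ = RingHom.id ℂ ∨ σ = starRingEnd ℂ) ∧
    (∀ x y, S (x + y) = S x + S y) ∧ (∀ (c : ℂ) (x : E), S (c • x) = σ c • S x) ∧
    ∀ x y, ⟪S x, S y⟫_ℂ = σ ⟪x, y⟫_ℂ := by
  obtain ⟨τ, hτ⟩ := hS.exists_smul hdim
  obtain ⟨u, hu, -⟩ := hdim 0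
  have hSu : S u ≠ 0 := mt hS.eq_zero_iff.mp hu
  have cancel : ∀ {a b : ℂ}, a • S u = b • S u → a = b := fun h => smul_left_injective ℂ hSu h
  let σ : ℂ →+* ℂ :=
    { toFun := τ
      map_one' := cancel (by rw [← hτ, one_smul, one_smul])
      map_zero' := cancel (by rw [← hτ, zero_smul, zero_smul, hS.map_zero])
      map_mul' := fun a b => cancel (by rw [← hτ, mul_smul, mul_smul, hτ, hτ])
      map_add' := fun a b => cancel (by rw [← hτ, add_smul, hS.map_add hdim, add_smul, hτ, hτ]) }
  have hσ : ∀ (c : ℂ) (x : E), S (c • x) = σ c • S x := hτ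
  have hinner : ∀ x y, ⟪S x, S y⟫_ℂ = σ ⟪x, y⟫_ℂ := by
    intro x y
    by_cases ha : ⟪x, y⟫_ℂ = 0
    · rw [ha, (hS.orth _ _).mp ha, _root_.map_zero]
    · have h1 : ⟪x, -(⟪x, y⟫_ℂ)⁻¹ • y⟫_ℂ = -1 := by
        rw [inner_smul_right, neg_mul, inv_mul_cancel₀ ha]
      rw [hS.neg_one, hσ, inner_smul_right, map_neg, map_inv₀, neg_mul, neg_inj] at h1
      have h2 : σ ⟪x, y⟫_ℂ ≠ 0 := (map_ne_zero σ).mpr ha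
      rw [inv_mul_eq_div, div_eq_one_iff_eq h2] at h1
      exact h1
  refine ⟨σ, ?_, hS.map_add hdim, hσ, hinner⟩
  -- Conjugate symmetry of the inner product passes to `σ`. So `σ` maps reals to reals, and the only
  -- ring endomorphism of `ℝ` is the identity; this yields continuity for free.
  have hconj : ∀ c : ℂ, σ (starRingEnd ℂ c) = starRingEnd ℂ (σ c) := by
    intro c
    have hn : ⟪u, u⟫_ℂ ≠ 0 := inner_self_ne_zero.mpr hu
    have h1 : ⟪u, (c / ⟪u, u⟫_ℂ) • u⟫_ℂ = c := by
      rw [inner_smul_right, div_mul_cancel₀ _ hn]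
    rw [← h1, inner_conj_symm, ← hinner, ← hinner, inner_conj_symm]
  have hre : ∀ r : ℝ, σ r = r := by
    have him : ∀ r : ℝ, ((σ r).re : ℂ) = σ r := fun r => by
      rw [← Complex.conj_eq_iff_re, ← hconj, Complex.conj_ofReal]
    let ρ : ℝ →+* ℝ :=
      { toFun := fun r => (σ r).re
        map_one' := by simp
        map_zero' := by simp
        map_mul' := fun a b => by
          have := him a
          rw [Complex.ofReal_mul, map_mul, ← him a, ← him b, ← Complex.ofReal_mul,
            Complex.ofReal_re, Complex.ofReal_re, Complex.ofReal_re]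
        map_add' := fun a b => by simp }
    have hρ : ρ = RingHom.id ℝ := Subsingleton.elim _ _
    intro r
    rw [← him r]
    exact congrArg Complex.ofReal (RingHom.congr_fun hρ r)
  let σ' : ℂ →ₐ[ℝ] ℂ := { σ with commutes' := hre }
  rcases Complex.real_algHom_eq_id_or_conj σ' with h | h
  · left
    ext c
    exact DFunLike.congr_fun h c
  · right
    ext c
    exact DFunLike.congr_fun h c

end IsChart

end Chart


/-! ### Uhlhorn's theorem on orthogonality-preserving maps of lines -/

section Uhlhorn

variable {H : Type*} [NormedAddCommGroup H] [InnerProductSpace ℂ H]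

/-- A map on vectors that induces a surjective map of lines which preserves orthogonality in both
directions. -/
structure IsOrthoMap (p : H → H) : Prop where
  ne_zero : ∀ x, x ≠ 0 → p x ≠ 0
  orth : ∀ x y, x ≠ 0 → y ≠ 0 → (⟪x, y⟫_ℂ = 0 ↔ ⟪p x, p y⟫_ℂ = 0)
  surj : ∀ y, y ≠ 0 → ∃ x, x ≠ 0 ∧ ∃ c : ℂ, y = c • p x

namespace IsOrthoMap

variable {p : H → H} (hp : IsOrthoMap p)
include hp

theorem parallel_of_orth {x : H} {v : H}
    (h : ∀ z, z ≠ 0 → ⟪x, z⟫_ℂ = 0 → ⟪v, p z⟫_ℂ = 0) (hx : x ≠ 0) : ∃ c : ℂ, v = c • p x := by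
  refine exists_smul_of_orthogonal fun z' hz' hxz => ?_
  obtain ⟨z, hz, c, rfl⟩ := hp.surj z' hz'
  have hc : c ≠ 0 := by rintro rfl; simp at hz'
  rw [inner_smul_right, mul_eq_zero, or_iff_right hc, ← hp.orth _ _ hx hz] at hxz
  rw [inner_smul_right, h z hz hxz, mul_zero]

theorem map_smul {x : H} (hx : x ≠ 0) {c : ℂ} (hc : c ≠ 0) : ∃ d : ℂ, p (c • x) = d • p x := by
  refine hp.parallel_of_orth (fun z hz hxz => ?_) hx
  rw [← hp.orth _ _ (smul_ne_zero hc hx) hz, inner_smul_left, hxz, mul_zero]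

/-- **Uhlhorn's theorem**: such a map is induced by a unitary or an antiunitary map. -/
theorem exists_semilinear (hdim : ∀ a b : H, ∃ c : H, c ≠ 0 ∧ ⟪a, c⟫_ℂ = 0 ∧ ⟪b, c⟫_ℂ = 0) :
    ∃ (σ : ℂ →+* ℂ) (S : H → H), (σ = RingHom.id ℂ ∨ σ = starRingEnd ℂ) ∧
      (∀ x y, S (x + y) = S x + S y) ∧ (∀ (c : ℂ) (x : H), S (c • x) = σ c • S x) ∧
      (∀ x y, ⟪S x, S y⟫_ℂ = σ ⟪x, y⟫_ℂ) ∧ Function.Surjective S ∧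
      ∀ x, x ≠ 0 → ∃ c : ℂ, p x = c • S x := by
  obtain ⟨e₀, he₀, -⟩ := hdim 0 0
  obtain ⟨e, he, hee⟩ : ∃ e : H, e ≠ 0 ∧ ⟪e, e⟫_ℂ = 1 := by
    refine ⟨((‖e₀‖⁻¹ : ℝ) : ℂ) • e₀, ?_, ?_⟩
    · simp [he₀]
    · have : (‖e₀‖ : ℂ) ≠ 0 := by simp [he₀]
      rw [inner_smul_left, inner_smul_right, inner_self_eq_norm_sq_to_K]
      simp
      field_simp
  obtain ⟨e', he', hee', k, hk0, hk⟩ : ∃ e' : H, e' ≠ 0 ∧ ⟪e', e'⟫_ℂ = 1 ∧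
      ∃ k : ℂ, k ≠ 0 ∧ e' = k • p e := by
    have h0 := hp.ne_zero e he
    have : (‖p e‖ : ℂ) ≠ 0 := by simp [h0]
    refine ⟨((‖p e‖⁻¹ : ℝ) : ℂ) • p e, ?_, ?_, _, ?_, rfl⟩
    · simp [h0]
    · rw [inner_smul_left, inner_smul_right, inner_self_eq_norm_sq_to_K]
      simp
      field_simp
    · simp [h0]
  have horth_e : ∀ x, x ≠ 0 → (⟪e, x⟫_ℂ = 0 ↔ ⟪e', p x⟫_ℂ = 0) := fun x hx => by
    rw [hp.orth e x he hx, hk, inner_smul_left, mul_eq_zero, or_iff_right (by simpa using hk0)]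
  let K := (ℂ ∙ e)ᗮ
  let K' := (ℂ ∙ e')ᗮ
  have hK : ∀ y : K, ⟪e, (y : H)⟫_ℂ = 0 := fun y =>
    Submodule.mem_orthogonal_singleton_iff_inner_right.mp y.2
  have hK' : ∀ y : K', ⟪e', (y : H)⟫_ℂ = 0 := fun y =>
    Submodule.mem_orthogonal_singleton_iff_inner_right.mp y.2
  have hKc : ∀ y : K, ⟪(y : H), e⟫_ℂ = 0 := fun y => inner_eq_zero_symm.mp (hK y)
  have hKc' : ∀ y : K', ⟪(y : H), e'⟫_ℂ = 0 := fun y => inner_eq_zero_symm.mp (hK' y)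
  have hey : ∀ y : K, ⟪e, e + (y : H)⟫_ℂ = 1 := fun y => by
    rw [inner_add_right, hee, hK, add_zero]
  have hey0 : ∀ y : K, e + (y : H) ≠ 0 := fun y h => by
    have := hey y
    rw [h, inner_zero_right] at this
    exact zero_ne_one this
  have hne : ∀ y : K, ⟪e', p (e + y)⟫_ℂ ≠ 0 := fun y => by
    rw [Ne, ← horth_e _ (hey0 y), hey]
    exact one_ne_zero
  -- An affine chart of projective space: a line not orthogonal to `e` contains exactly one vector
  -- `e + y` with `y ⟂ e`. Lines through `e + y` and `e + z` are orthogonal exactly when `⟪y, z⟫ =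
  -- -1`, hence the value -1 in `IsChart`.
  let S : K → K' := fun y => ⟨(⟪e', p (e + y)⟫_ℂ)⁻¹ • p (e + y) - e', by
    rw [Submodule.mem_orthogonal_singleton_iff_inner_right, inner_sub_right, inner_smul_right,
      inv_mul_cancel₀ (hne y), hee', sub_self]⟩
  have hSval : ∀ y : K, e' + (S y : H) = (⟪e', p (e + y)⟫_ℂ)⁻¹ • p (e + y) := fun y => by
    simp [S]
  have hSp : ∀ y : K, p (e + y) = ⟪e', p (e + y)⟫_ℂ • (e' + (S y : H)) := fun y => by
    rw [hSval, smul_smul, mul_inv_cancel₀ (hne y), one_smul]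
  have hS_orth : ∀ (y : K) (z : H), ⟪e' + (S y : H), z⟫_ℂ = 0 ↔ ⟪p (e + y), z⟫_ℂ = 0 := by
    intro y z
    rw [hSval, inner_smul_left, mul_eq_zero,
      or_iff_right ((_root_.map_ne_zero (starRingEnd ℂ)).mpr (inv_ne_zero (hne y)))]
  -- the chart maps a vector into its own line
  have hline : ∀ y : K, (y : H) ≠ 0 → ∃ c : ℂ, (S y : H) = c • p y := by
    intro y hy
    have hepy : ⟪e', p y⟫_ℂ = 0 := (horth_e _ hy).mp (hK y)
    have hpye : ⟪p y, e'⟫_ℂ = 0 := inner_eq_zero_symm.mp hepy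
    refine exists_smul_of_orthogonal fun z' _ hz => ?_
    -- Removing the `e'` component does not change the inner product with `S y`. The vector `w`
    -- comes from some `v` orthogonal to `e` and `y`, hence to `e + y`, so `w` is orthogonal to `e'
    -- + S y` and therefore to `S y`.
    set w : H := z' - ⟪e', z'⟫_ℂ • e' with hw
    have hew : ⟪e', w⟫_ℂ = 0 := by
      rw [hw, inner_sub_right, inner_smul_right, hee', mul_one, sub_self]
    have hyw : ⟪p y, w⟫_ℂ = 0 := by
      rw [hw, inner_sub_right, inner_smul_right, hpye, mul_zero, hz, sub_zero]
    have hSw : ⟪(S y : H), z'⟫_ℂ = ⟪(S y : H), w⟫_ℂ := by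
      rw [hw, inner_sub_right, inner_smul_right, hKc', mul_zero, sub_zero]
    rw [hSw]
    by_cases hw0 : w = 0
    · rw [hw0, inner_zero_right]
    obtain ⟨v, hv, c, hc⟩ := hp.surj w hw0
    have hc0 : c ≠ 0 := by rintro rfl; simp [hc] at hw0
    have hev : ⟪e, v⟫_ℂ = 0 := by
      rw [horth_e v hv]
      rw [hc, inner_smul_right, mul_eq_zero, or_iff_right hc0] at hew
      exact hew
    have hyv : ⟪(y : H), v⟫_ℂ = 0 := by
      rw [hp.orth _ _ hy hv]
      rw [hc, inner_smul_right, mul_eq_zero, or_iff_right hc0] at hyw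
      exact hyw
    have h1 : ⟪e' + (S y : H), w⟫_ℂ = 0 := by
      rw [hS_orth, hc, inner_smul_right, (hp.orth _ _ (hey0 y) hv).mp, mul_zero]
      rw [inner_add_left, hev, hyv, add_zero]
    rwa [inner_add_left, hew, zero_add] at h1
  have hS0 : S 0 = 0 := by
    have h1 := hSval 0
    have h2 : p e = k⁻¹ • e' := by rw [hk, smul_smul, inv_mul_cancel₀ hk0, one_smul]
    have h3 : (e' : H) + (S 0 : H) = e' := by
      rw [h1, ZeroMemClass.coe_zero, add_zero, h2, inner_smul_right, hee', smul_smul, mul_one,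
        inv_mul_cancel₀ (inv_ne_zero hk0), one_smul]
    exact Subtype.ext (by simpa using h3)
  have hSne : ∀ y : K, y ≠ 0 → S y ≠ 0 := by
    intro y hy h0
    have hy' : (y : H) ≠ 0 := by simpa using hy
    have h1 := (hS_orth y (p y)).not.mpr (by
      rw [← hp.orth _ _ (hey0 y) hy', inner_add_left, hK, zero_add, inner_self_eq_zero]
      exact hy')
    apply h1
    rw [h0, ZeroMemClass.coe_zero, add_zero]
    exact (horth_e _ hy').mp (hK y)
  have hchart : IsChart S := by
    refine ⟨?_, ?_, ?_⟩
    · intro y'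
      have h1 : ⟪e', e' + (y' : H)⟫_ℂ = 1 := by rw [inner_add_right, hee', hK', add_zero]
      have h0 : e' + (y' : H) ≠ 0 := fun h => by
        rw [h, inner_zero_right] at h1
        exact zero_ne_one h1
      obtain ⟨x, hx, c, hc⟩ := hp.surj _ h0
      have hex : ⟪e, x⟫_ℂ ≠ 0 := by
        rw [Ne, horth_e x hx]
        intro h
        rw [hc, inner_smul_right, h, mul_zero] at h1
        exact zero_ne_one h1
      let y : K := ⟨(⟪e, x⟫_ℂ)⁻¹ • x - e, by
        rw [Submodule.mem_orthogonal_singleton_iff_inner_right, inner_sub_right, inner_smul_right,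
          inv_mul_cancel₀ hex, hee, sub_self]⟩
      have hxy : x = ⟪e, x⟫_ℂ • (e + (y : H)) := by
        simp only [y, add_sub_cancel]
        rw [smul_smul, mul_inv_cancel₀ hex, one_smul]
      obtain ⟨d, hd⟩ := hp.map_smul (hey0 y) hex
      rw [← hxy, hSp] at hd
      rw [hd, smul_smul, smul_smul] at hc
      have h2 := h1
      rw [hc, inner_smul_right, inner_add_right, hee', hK', add_zero, mul_one] at h2
      rw [h2, one_smul] at hc
      exact ⟨y, Subtype.ext (add_left_cancel hc).symm⟩
    · intro y z
      by_cases hy : y = 0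
      · simp [hy, hS0]
      by_cases hz : z = 0
      · simp [hz, hS0]
      have hy' : (y : H) ≠ 0 := by simpa using hy
      have hz' : (z : H) ≠ 0 := by simpa using hz
      obtain ⟨a, ha⟩ := hline y hy'
      obtain ⟨b, hb⟩ := hline z hz'
      have ha0 : a ≠ 0 := by
        rintro rfl
        exact hSne y hy (Subtype.ext (by simpa using ha))
      have hb0 : b ≠ 0 := by
        rintro rfl
        exact hSne z hz (Subtype.ext (by simpa using hb))
      rw [Submodule.coe_inner, Submodule.coe_inner, ha, hb, inner_smul_left, inner_smul_right,
        hp.orth _ _ hy' hz']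
      simp [ha0, hb0]
    · intro y z
      have h1 : ⟪(y : H), (z : H)⟫_ℂ = -1 ↔ ⟪e + (y : H), e + (z : H)⟫_ℂ = 0 := by
        rw [inner_add_left, hey, inner_add_right, hKc, zero_add, add_comm, add_eq_zero_iff_eq_neg]
      have h2 : ⟪(S y : H), (S z : H)⟫_ℂ = -1 ↔ ⟪e' + (S y : H), e' + (S z : H)⟫_ℂ = 0 := by
        rw [inner_add_left, inner_add_right, inner_add_right, hKc', hK', hee', zero_add, add_zero,
          add_comm, add_eq_zero_iff_eq_neg]
      rw [Submodule.coe_inner, Submodule.coe_inner, h1, h2, hS_orth, inner_eq_zero_symm,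
        inner_eq_zero_symm (x := p (e + y)), hS_orth, inner_eq_zero_symm,
        hp.orth _ _ (hey0 y) (hey0 z)]
      exact inner_eq_zero_symm
  -- One of the two orthogonality conditions in `hdim` is spent on `e`, to stay inside its
  -- complement.
  have hdimK : ∀ a : K, ∃ c : K, c ≠ 0 ∧ ⟪a, c⟫_ℂ = 0 := fun a => by
    obtain ⟨c, hc, h1, h2⟩ := hdim e a
    exact ⟨⟨c, Submodule.mem_orthogonal_singleton_iff_inner_right.mpr h1⟩,
      fun h => hc (congrArg Subtype.val h), h2⟩
  obtain ⟨σ, hσ, hadd, hsmul, hinner⟩ := hchart.exists_semilinear hdimK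
  have hσ1 : ∀ a, σ (starRingEnd ℂ a) = starRingEnd ℂ (σ a) := by
    rcases hσ with rfl | rfl <;> simp
  have hσsurj : Function.Surjective σ := by
    rcases hσ with rfl | rfl
    · exact Function.surjective_id
    · exact fun c => ⟨starRingEnd ℂ c, by simp⟩
  let π : H →ₗ[ℂ] K :=
    { toFun := fun x => ⟨x - ⟪e, x⟫_ℂ • e, by
        rw [Submodule.mem_orthogonal_singleton_iff_inner_right, inner_sub_right, inner_smul_right,
          hee, mul_one, sub_self]⟩
      map_add' := fun x y => Subtype.ext (by
        simp only [inner_add_right, add_smul, Submodule.coe_add]; abel)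
      map_smul' := fun c x => Subtype.ext (by
        simp only [inner_smul_right, mul_smul, Submodule.coe_smul, smul_sub, RingHom.id_apply]) }
  have hπ : ∀ x : H, ⟪e, x⟫_ℂ • e + (π x : H) = x := fun x => by simp [π]
  refine ⟨σ, fun x => σ ⟪e, x⟫_ℂ • e' + (S (π x) : H), hσ, ?_, ?_, ?_, ?_, ?_⟩
  · intro x y
    simp only [inner_add_right, _root_.map_add, hadd, Submodule.coe_add, add_smul]
    abel
  · intro c x
    simp only [inner_smul_right, _root_.map_mul, _root_.map_smul, hsmul, Submodule.coe_smul,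
      smul_add, mul_smul]
  · intro x y
    have h1 : ⟪x, y⟫_ℂ = starRingEnd ℂ ⟪e, x⟫_ℂ * ⟪e, y⟫_ℂ + ⟪π x, π y⟫_ℂ := by
      conv_lhs => rw [← hπ x, ← hπ y]
      simp only [inner_add_left, inner_add_right, inner_smul_left, inner_smul_right, hee, hK, hKc,
        Submodule.coe_inner]
      ring
    rw [h1, _root_.map_add, _root_.map_mul, hσ1, ← hinner]
    simp only [inner_add_left, inner_add_right, inner_smul_left, inner_smul_right, hee', hK', hKc',
        Submodule.coe_inner]
    ring
  · intro y'
    obtain ⟨a, ha⟩ := hσsurj ⟪e', y'⟫_ℂ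
    obtain ⟨y, hy⟩ := hchart.surj ⟨y' - ⟪e', y'⟫_ℂ • e', by
        rw [Submodule.mem_orthogonal_singleton_iff_inner_right, inner_sub_right, inner_smul_right,
          hee', mul_one, sub_self]⟩
    refine ⟨a • e + y, ?_⟩
    have h1 : ⟪e, a • e + (y : H)⟫_ℂ = a := by
      rw [inner_add_right, inner_smul_right, hee, hK, mul_one, add_zero]
    have h2 : π (a • e + (y : H)) = y := by
      have := hπ (a • e + (y : H))
      rw [h1] at this
      exact Subtype.ext (add_left_cancel this)
    simp only [h1, h2, ha, hy]
    abel
  · intro x hx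
    -- Lines orthogonal to `e` lie outside the chart and are covered by `hline`; any other line is
    -- rescaled into the chart.
    by_cases ha : ⟪e, x⟫_ℂ = 0
    · have hπx : (π x : H) = x := by
        have := hπ x
        rwa [ha, zero_smul, zero_add] at this
      obtain ⟨c, hc⟩ := hline (π x) (by rwa [hπx])
      have hc0 : c ≠ 0 := by
        rintro rfl
        refine hSne (π x) (fun h => hx ?_) (Subtype.ext (by simpa using hc))
        rw [← hπx, h]; rfl
      refine ⟨c⁻¹, ?_⟩
      change p x = c⁻¹ • (σ ⟪e, x⟫_ℂ • e' + (S (π x) : H))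
      rw [ha, _root_.map_zero, zero_smul, zero_add, hc, hπx, smul_smul, inv_mul_cancel₀ hc0,
        one_smul]
    · set a := ⟪e, x⟫_ℂ with hadef
      have h1 : a • (e + ((a⁻¹ • π x : K) : H)) = x := by
        rw [smul_add, Submodule.coe_smul, smul_smul, mul_inv_cancel₀ ha, one_smul, hπ]
      obtain ⟨d, hd⟩ := hp.map_smul (hey0 (a⁻¹ • π x)) ha
      rw [h1, hSp, hsmul, smul_smul] at hd
      refine ⟨d * ⟪e', p (e + ((a⁻¹ • π x : K) : H))⟫_ℂ * σ a⁻¹, ?_⟩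
      rw [hd, mul_smul _ (σ a⁻¹), smul_add (σ a⁻¹), smul_smul (σ a⁻¹), ← _root_.map_mul,
        inv_mul_cancel₀ ha, _root_.map_one, one_smul]
      rfl

end IsOrthoMap
end Uhlhorn


/-! ### Properties of a relation expressed through commutants -/

section CommutantOrder

variable {α : Type*} (r : α → α → Prop)

/-- `a` is related to everything. -/
def IsCentralFor (a : α) : Prop := ∀ b, r a b

/-- The commutant of `a` is contained in the commutant of `b`. -/
def CommutantLE (a b : α) : Prop := ∀ c, r a c → r b c

/-- The commutant of `a` is maximal among the commutants of non-central elements. -/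
def HasMaximalCommutant (a : α) : Prop :=
  ¬ IsCentralFor r a ∧ ∀ b, ¬ IsCentralFor r b → CommutantLE r a b → CommutantLE r b a

/-- A description in terms of commutants of the self-adjoint operators `α P + β` with `P` a
projection of rank one or of corank one. -/
def IsAtomic (a : α) : Prop :=
  HasMaximalCommutant r a ∧ ∀ q s, HasMaximalCommutant r q → r a q →
    (∀ c, r a c → r q c → r s c) → ¬ CommutantLE r a s → ∀ c, r a c → r s c → r q c

variable {r}

theorem HasMaximalCommutant.congr {a b : α} (hab : ∀ c, r a c ↔ r b c)
    (h : HasMaximalCommutant r a) : HasMaximalCommutant r b := by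
  simpa only [HasMaximalCommutant, IsCentralFor, CommutantLE, hab] using h

theorem IsAtomic.congr {a b : α} (hab : ∀ c, r a c ↔ r b c) (h : IsAtomic r a) :
    IsAtomic r b := by
  refine ⟨h.1.congr hab, ?_⟩
  simpa only [CommutantLE, hab] using h.2

variable {β : Type*} {r' : β → β → Prop} {Φ : α → β}

/-- Surjectivity turns each quantifier over the target into one over the source, so injectivity is
not needed. -/
theorem hasMaximalCommutant_map_iff (hΦ : Function.Surjective Φ)
    (h : ∀ a b, r a b ↔ r' (Φ a) (Φ b)) (a : α) :
    HasMaximalCommutant r' (Φ a) ↔ HasMaximalCommutant r a := by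
  simp only [HasMaximalCommutant, IsCentralFor, CommutantLE, hΦ.forall, ← h]

theorem isAtomic_map_iff (hΦ : Function.Surjective Φ)
    (h : ∀ a b, r a b ↔ r' (Φ a) (Φ b)) (a : α) : IsAtomic r' (Φ a) ↔ IsAtomic r a := by
  simp only [IsAtomic, hasMaximalCommutant_map_iff hΦ h, CommutantLE, hΦ.forall, ← h]

end CommutantOrder

/-! ### Self-adjoint operators with maximal commutant are affine in a projection -/

section Operators

variable {H : Type*} [NormedAddCommGroup H] [InnerProductSpace ℂ H]

theorem exists_eq_smul_of_forall_mem (V : Submodule ℂ H) (T : H →L[ℂ] H)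
    (h : ∀ y ∈ V, ∃ c : ℂ, T y = c • y) : ∃ c : ℂ, ∀ y ∈ V, T y = c • y := by
  let f : V →ₗ[ℂ] V := LinearMap.codRestrict V ((T : H →ₗ[ℂ] H).domRestrict V) fun y => by
    obtain ⟨c, hc⟩ := h y y.2
    simpa [hc] using V.smul_mem c y.2
  obtain ⟨c, hc⟩ := LinearMap.exists_eq_smul_id_of_forall_notLinearIndependent (f := f) fun v => by
    obtain ⟨c, hc⟩ := h v v.2
    rw [LinearIndependent.pair_iff]
    push Not
    exact ⟨c, -1, Subtype.ext (by simp [f, hc]), fun _ => by simp⟩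
  exact ⟨c, fun y hy => congrArg Subtype.val (LinearMap.congr_fun hc ⟨y, hy⟩)⟩

theorem commute_smul_add_iff {P T : H →L[ℂ] H} {a b : ℂ} (ha : a ≠ 0) :
    Commute (a • P + b • (1 : H →L[ℂ] H)) T ↔ Commute P T := by
  constructor
  · intro h
    have h1 := (h.sub_left ((Commute.one_left T).smul_left b)).smul_left a⁻¹
    rwa [add_sub_cancel_right, smul_smul, inv_mul_cancel₀ ha, one_smul] at h1
  · intro h
    exact (h.smul_left a).add_left ((Commute.one_left T).smul_left b)

variable [CompleteSpace H]

theorem inner_apply_left_of_selfAdjoint {T : H →L[ℂ] H} (hT : IsSelfAdjoint T) (x y : H) :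
    ⟪T x, y⟫_ℂ = ⟪x, T y⟫_ℂ :=
  hT.isSymmetric x y

theorem exists_real_smul_one {T : H →L[ℂ] H} (hT : IsSelfAdjoint T)
    (h : ∀ x, ∃ c : ℂ, T x = c • x) : ∃ c : ℝ, T = (c : ℂ) • (1 : H →L[ℂ] H) := by
  obtain ⟨c, hc⟩ := exists_eq_smul_of_forall_mem ⊤ T fun y _ => h y
  by_cases hH : ∃ x : H, x ≠ 0
  · obtain ⟨x, hx⟩ := hH
    have h1 := inner_apply_left_of_selfAdjoint hT x x
    rw [hc x trivial, inner_smul_left, inner_smul_right] at h1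
    have h2 := mul_right_cancel₀ (inner_self_ne_zero.mpr hx) h1
    refine ⟨c.re, ?_⟩
    rw [Complex.conj_eq_iff_re.mp h2]
    ext y
    simpa using hc y trivial
  · push Not at hH
    exact ⟨0, by ext y; simp [hH y]⟩

/-- The self-adjoint operator `z ↦ ⟪x, z⟫ x`. -/
def rankOneSelf (x : H) : selfAdjoint (H →L[ℂ] H) :=
  ⟨InnerProductSpace.rankOne ℂ x x,
    ContinuousLinearMap.isSelfAdjoint_iff_isSymmetric.mpr
      (InnerProductSpace.isSymmetric_rankOne_self x)⟩

@[simp] theorem rankOneSelf_apply (x z : H) :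
    (rankOneSelf x : H →L[ℂ] H) z = ⟪x, z⟫_ℂ • x := rfl

theorem apply_eq_smul_of_commute {T : H →L[ℂ] H} {x : H}
    (h : Commute T (rankOneSelf x : H →L[ℂ] H)) : ∃ c : ℂ, T x = c • x := by
  by_cases hx : x = 0
  · exact ⟨0, by simp [hx]⟩
  have h1 : T (⟪x, x⟫_ℂ • x) = ⟪x, T x⟫_ℂ • x := DFunLike.congr_fun h.eq x
  rw [map_smul] at h1
  refine ⟨(⟪x, x⟫_ℂ)⁻¹ * ⟪x, T x⟫_ℂ, ?_⟩
  rw [mul_smul, ← h1, smul_smul, inv_mul_cancel₀ (inner_self_ne_zero.mpr hx), one_smul]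

theorem commute_of_apply_eq_smul {T : H →L[ℂ] H} (hT : IsSelfAdjoint T) {x : H} {c : ℂ}
    (h : T x = c • x) : Commute T (rankOneSelf x : H →L[ℂ] H) := by
  refine ContinuousLinearMap.ext fun z => ?_
  change T (⟪x, z⟫_ℂ • x) = ⟪x, T z⟫_ℂ • x
  by_cases hx : x = 0
  · simp [hx]
  have h1 := inner_apply_left_of_selfAdjoint hT x x
  rw [h, inner_smul_left, inner_smul_right] at h1
  have h2 := mul_right_cancel₀ (inner_self_ne_zero.mpr hx) h1
  rw [map_smul, ← inner_apply_left_of_selfAdjoint hT, h, inner_smul_left, h2, smul_smul, mul_comm]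

/-- The self-adjoint operator `z ↦ ⟪v, z⟫ u + ⟪u, z⟫ v`. -/
def rankTwoSwap (u v : H) : selfAdjoint (H →L[ℂ] H) :=
  ⟨InnerProductSpace.rankOne ℂ u v + InnerProductSpace.rankOne ℂ v u, by
    rw [selfAdjoint.mem_iff, star_add, ContinuousLinearMap.star_eq_adjoint,
      ContinuousLinearMap.star_eq_adjoint, InnerProductSpace.adjoint_rankOne,
      InnerProductSpace.adjoint_rankOne, add_comm]⟩

@[simp] theorem rankTwoSwap_apply (u v z : H) :
    (rankTwoSwap u v : H →L[ℂ] H) z = ⟪v, z⟫_ℂ • u + ⟪u, z⟫_ℂ • v := rfl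

theorem commute_rankTwoSwap {T : H →L[ℂ] H} (hT : IsSelfAdjoint T) {u v : H} {c : ℝ}
    (hu : T u = (c : ℂ) • u) (hv : T v = (c : ℂ) • v) :
    Commute T (rankTwoSwap u v : H →L[ℂ] H) := by
  refine ContinuousLinearMap.ext fun z => ?_
  change T (⟪v, z⟫_ℂ • u + ⟪u, z⟫_ℂ • v) = ⟪v, T z⟫_ℂ • u + ⟪u, T z⟫_ℂ • v
  rw [map_add, map_smul, map_smul, ← inner_apply_left_of_selfAdjoint hT,
    ← inner_apply_left_of_selfAdjoint hT, hu, hv, inner_smul_left, inner_smul_left,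
    Complex.conj_ofReal, smul_smul, smul_smul, mul_comm, mul_comm (c : ℂ) ⟪u, z⟫_ℂ]

/-- Commutation of self-adjoint operators. -/
def Comm (A B : selfAdjoint (H →L[ℂ] H)) : Prop := Commute (A : H →L[ℂ] H) (B : H →L[ℂ] H)

/-- A noncentral self-adjoint projection has a maximal commutant. -/
theorem hasMaximalCommutant_of_projection {P : selfAdjoint (H →L[ℂ] H)}
    (hP : (P : H →L[ℂ] H) * P = P) (hc : ¬ IsCentralFor Comm P) :
    HasMaximalCommutant Comm P := by
  refine ⟨hc, fun B hB hPB => ?_⟩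
  have hPP : ∀ z, (P : H →L[ℂ] H) ((P : H →L[ℂ] H) z) = (P : H →L[ℂ] H) z :=
    fun z => DFunLike.congr_fun hP z
  -- An eigenvector of `P` gives a rank one operator commuting with `P`, hence with `B`, and so is
  -- an eigenvector of `B`. Thus `B` is scalar on the range and on the kernel of `P`.
  have key : ∀ (k : ℂ) (y : H), (P : H →L[ℂ] H) y = k • y → ∃ c : ℂ, (B : H →L[ℂ] H) y = c • y :=
    fun k y hy => apply_eq_smul_of_commute (hPB (rankOneSelf y) (commute_of_apply_eq_smul P.2 hy))
  obtain ⟨c, hc1⟩ := exists_eq_smul_of_forall_mem (LinearMap.range (P : H →L[ℂ] H).toLinearMap)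
    (B : H →L[ℂ] H) (by
      rintro _ ⟨z, rfl⟩
      exact key 1 _ (by rw [one_smul]; exact hPP z))
  obtain ⟨d, hd1⟩ := exists_eq_smul_of_forall_mem (LinearMap.ker (P : H →L[ℂ] H).toLinearMap)
    (B : H →L[ℂ] H) (fun y hy => key 0 y (by rw [zero_smul]; exact hy))
  have hBeq : (B : H →L[ℂ] H) = (c - d) • (P : H →L[ℂ] H) + d • 1 := by
    ext z
    have h1 := hc1 _ ⟨z, rfl⟩
    have h2 := hd1 (z - (P : H →L[ℂ] H) z) (by
      change (P : H →L[ℂ] H) (z - (P : H →L[ℂ] H) z) = 0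
      rw [map_sub, hPP, sub_self])
    change (B : H →L[ℂ] H) ((P : H →L[ℂ] H) z) = c • (P : H →L[ℂ] H) z at h1
    rw [map_sub, h1] at h2
    change (B : H →L[ℂ] H) z = (c - d) • (P : H →L[ℂ] H) z + d • z
    rw [eq_add_of_sub_eq h2, smul_sub, sub_smul]
    abel
  have hcd : c - d ≠ 0 := fun h => hB fun T => by
    unfold Comm
    rw [hBeq, h, zero_smul, zero_add]
    exact (Commute.one_left _).smul_left d
  intro T hT
  unfold Comm at hT ⊢
  rwa [hBeq, commute_smul_add_iff hcd] at hT

/-- The tent function of height and half-width `δ` at `c`. -/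
def tent (δ c t : ℝ) : ℝ := max 0 (δ - |t - c|)

theorem continuous_tent (δ c : ℝ) : Continuous (tent δ c) := by
  unfold tent; fun_prop

theorem tent_mul_tent {δ c d : ℝ} (h : 2 * δ ≤ |c - d|) (t : ℝ) :
    tent δ c t * tent δ d t = 0 := by
  unfold tent
  by_cases h1 : δ - |t - c| ≤ 0
  · rw [max_eq_left h1, zero_mul]
  · rw [max_eq_left (b := δ - |t - d|), mul_zero]
    have := abs_sub_le c t d
    rw [abs_sub_comm c t] at this
    linarith

theorem cfc_tent_ne_zero {A : H →L[ℂ] H} (hA : IsSelfAdjoint A) {δ c : ℝ} (hδ : 0 < δ)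
    (hc : c ∈ spectrum ℝ A) : cfc (tent δ c) A ≠ 0 := by
  intro h
  have h1 : cfc (tent δ c) A = cfc (fun _ : ℝ => (0 : ℝ)) A := by rw [h, cfc_const_zero]
  rw [cfc_eq_cfc_iff_eqOn hA (continuous_tent δ c).continuousOn continuousOn_const] at h1
  have := h1 hc
  simp [tent] at this
  linarith

theorem cfc_tent_mul {A : H →L[ℂ] H} {δ c d : ℝ} (h : 2 * δ ≤ |c - d|) :
    cfc (tent δ c) A * cfc (tent δ d) A = 0 := by
  rw [← cfc_mul _ _ A (continuous_tent δ c).continuousOn (continuous_tent δ d).continuousOn]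
  simp only [tent_mul_tent h]
  exact cfc_const_zero ℝ A

/-- A self-adjoint operator with three points in its spectrum does not have a maximal
commutant. -/
theorem not_hasMaximalCommutant_of_spectrum {A : selfAdjoint (H →L[ℂ] H)} {a b c : ℝ}
    (ha : a ∈ spectrum ℝ (A : H →L[ℂ] H)) (hb : b ∈ spectrum ℝ (A : H →L[ℂ] H))
    (hc : c ∈ spectrum ℝ (A : H →L[ℂ] H)) (hab : a ≠ b) (hac : a ≠ c) (hbc : b ≠ c) :
    ¬ HasMaximalCommutant Comm A := by
  intro hmax
  obtain ⟨δ, hδ, h1, h2, h3⟩ : ∃ δ : ℝ, 0 < δ ∧ 2 * δ ≤ |a - b| ∧ 2 * δ ≤ |a - c| ∧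
      2 * δ ≤ |b - c| := by
    have h1 := abs_pos.mpr (sub_ne_zero.mpr hab)
    have h2 := abs_pos.mpr (sub_ne_zero.mpr hac)
    have h3 := abs_pos.mpr (sub_ne_zero.mpr hbc)
    refine ⟨min (|a - b|) (min (|a - c|) (|b - c|)) / 2, by positivity, ?_, ?_, ?_⟩
    · linarith [min_le_left (|a - b|) (min (|a - c|) (|b - c|))]
    · linarith [min_le_right (|a - b|) (min (|a - c|) (|b - c|)),
        min_le_left (|a - c|) (|b - c|)]
    · linarith [min_le_right (|a - b|) (min (|a - c|) (|b - c|)),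
        min_le_right (|a - c|) (|b - c|)]
  have hsa : ∀ d, IsSelfAdjoint (cfc (tent δ d) (A : H →L[ℂ] H)) := fun d => cfc_predicate _ _
  set F : H →L[ℂ] H := cfc (tent δ a) (A : H →L[ℂ] H) with hF
  set G : H →L[ℂ] H := cfc (tent δ b) (A : H →L[ℂ] H) with hG
  set K : H →L[ℂ] H := cfc (tent δ c) (A : H →L[ℂ] H) with hK
  have hFG : ∀ z, F (G z) = 0 := fun z => DFunLike.congr_fun (cfc_tent_mul h1) z
  have hFK : ∀ z, F (K z) = 0 := fun z => DFunLike.congr_fun (cfc_tent_mul h2) z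
  have hGK : ∀ z, G (K z) = 0 := fun z => DFunLike.congr_fun (cfc_tent_mul h3) z
  have hex : ∀ {T : H →L[ℂ] H}, T ≠ 0 → ∃ z, T z ≠ 0 := fun {T} hT => by
    by_contra! h
    exact hT (ContinuousLinearMap.ext h)
  obtain ⟨z₁, hz₁⟩ := hex (cfc_tent_ne_zero A.2 hδ hb)
  obtain ⟨z₂, hz₂⟩ := hex (cfc_tent_ne_zero A.2 hδ hc)
  rw [← hG] at hz₁
  rw [← hK] at hz₂
  have horth : ⟪G z₁, K z₂⟫_ℂ = 0 := by
    rw [inner_apply_left_of_selfAdjoint (hsa b), ← hG, hGK, inner_zero_right]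
  let F' : selfAdjoint (H →L[ℂ] H) := ⟨F, hsa a⟩
  -- A central `F` would be a nonzero scalar, contradicting `F * G = 0` with `G ≠ 0`.
  have hF' : ¬ IsCentralFor Comm F' := by
    intro h
    obtain ⟨k, hk⟩ := exists_real_smul_one (hsa a) fun x =>
      apply_eq_smul_of_commute (h (rankOneSelf x))
    rw [← hF] at hk
    have hk0 : (k : ℂ) ≠ 0 := by
      intro h0
      rw [h0, zero_smul] at hk
      exact cfc_tent_ne_zero A.2 hδ ha hk
    have := hFG z₁
    rw [hk] at this
    simp only [smul_apply, one_apply_eq_self] at this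
    exact (smul_ne_zero hk0 hz₁) this
  have hAF : CommutantLE Comm A F' := fun T hT => Commute.cfc_real hT _
  -- The swap lives in the kernel of `F`, so it commutes with `F`, and by maximality with `A` and
  -- with `G`, a function of `A`. But it exchanges a vector from the range of `G` with one killed by
  -- `G`.
  have hX : Comm F' (rankTwoSwap (G z₁) (K z₂)) :=
    commute_rankTwoSwap (c := 0) (hsa a) (by simpa using hFG z₁) (by simpa using hFK z₂)
  have hAX : Comm A (rankTwoSwap (G z₁) (K z₂)) := hmax.2 F' hF' hAF _ hX
  have hGX : Commute G (rankTwoSwap (G z₁) (K z₂) : H →L[ℂ] H) := Commute.cfc_real hAX _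
  have h4 := DFunLike.congr_fun hGX.eq (K z₂)
  simp only [mul_apply_eq_comp, rankTwoSwap_apply, hGK, inner_zero_right, zero_smul,
    add_zero, horth, map_smul] at h4
  rw [smul_eq_zero, or_iff_right (inner_self_ne_zero.mpr hz₂)] at h4
  apply hz₁
  rw [← inner_self_eq_zero (𝕜 := ℂ), inner_apply_left_of_selfAdjoint (hsa b), ← hG, h4,
    inner_zero_right]

/-- A self-adjoint operator with a maximal commutant is an affine function of a projection. -/
theorem HasMaximalCommutant.exists_projection {A : selfAdjoint (H →L[ℂ] H)}
    (hA : HasMaximalCommutant Comm A) :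
    ∃ (P : selfAdjoint (H →L[ℂ] H)) (a b : ℝ), (P : H →L[ℂ] H) * P = P ∧ a ≠ 0 ∧
      (A : H →L[ℂ] H) = (a : ℂ) • (P : H →L[ℂ] H) + (b : ℂ) • 1 := by
  have hspec : ∃ a b : ℝ, ∀ t ∈ spectrum ℝ (A : H →L[ℂ] H), t = a ∨ t = b := by
    by_contra! h
    obtain ⟨a, ha, -⟩ := h 0 0
    obtain ⟨b, hb, hba, -⟩ := h a a
    obtain ⟨c, hc, hca, hcb⟩ := h a b
    exact not_hasMaximalCommutant_of_spectrum ha hb hc hba.symm hca.symm hcb.symm hA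
  obtain ⟨a, b, hab⟩ := hspec
  have hsaA : IsSelfAdjoint (A : H →L[ℂ] H) := A.2
  have hne : a - b ≠ 0 := by
    intro h0
    have h1 : cfc (fun t : ℝ => t) (A : H →L[ℂ] H) = cfc (fun _ : ℝ => a) (A : H →L[ℂ] H) :=
      cfc_congr fun t ht => by
        rcases hab t ht with h | h
        · exact h
        · rw [h]; linarith
    rw [cfc_id' ℝ (A : H →L[ℂ] H), cfc_const a (A : H →L[ℂ] H),
      Algebra.algebraMap_eq_smul_one] at h1
    refine hA.1 fun T => ?_
    unfold Comm
    rw [h1]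
    exact (Commute.one_left _).smul_left a
  -- The affine function with value 1 at `a` and 0 at `b` is idempotent on the spectrum.
  let f : ℝ → ℝ := fun t => (a - b)⁻¹ * (t - b)
  have hf : Continuous f := by fun_prop
  refine ⟨⟨cfc f (A : H →L[ℂ] H), cfc_predicate _ _⟩, a - b, b, ?_, hne, ?_⟩
  · change cfc f (A : H →L[ℂ] H) * cfc f (A : H →L[ℂ] H) = cfc f (A : H →L[ℂ] H)
    rw [← cfc_mul f f _ hf.continuousOn hf.continuousOn]
    refine cfc_congr fun t ht => ?_
    rcases hab t ht with rfl | rfl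
    · simp [f, hne]
    · simp [f]
  · change (A : H →L[ℂ] H) = ((a - b : ℝ) : ℂ) • cfc f (A : H →L[ℂ] H) + (b : ℂ) • 1
    rw [Complex.coe_smul, Complex.coe_smul, ← cfc_smul (a - b) f _ hf.continuousOn,
      ← Algebra.algebraMap_eq_smul_one, ← cfc_const b (A : H →L[ℂ] H),
      ← cfc_add _ _ _ (by fun_prop) (by fun_prop)]
    conv_lhs => rw [← cfc_id' ℝ (A : H →L[ℂ] H)]
    refine cfc_congr fun t _ => ?_
    simp [f, hne]

end Operators


/-! ### Atomic operators are those of rank or corank one, up to affine change -/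

section RankOne

variable {H : Type*} [NormedAddCommGroup H] [InnerProductSpace ℂ H]

theorem exists_eq_smul_norm_one {x : H} (hx : x ≠ 0) :
    ∃ (u : H) (c : ℝ), ‖u‖ = 1 ∧ c ≠ 0 ∧ x = (c : ℂ) • u := by
  have h0 : ‖x‖ ≠ 0 := norm_ne_zero_iff.mpr hx
  refine ⟨((‖x‖⁻¹ : ℝ) : ℂ) • x, ‖x‖, ?_, h0, ?_⟩
  · rw [norm_smul, Complex.norm_real, norm_inv, norm_norm, inv_mul_cancel₀ h0]
  · rw [smul_smul, ← Complex.ofReal_mul, mul_inv_cancel₀ h0, Complex.ofReal_one, one_smul]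

variable [CompleteSpace H]

theorem rankOneSelf_smul (c : ℂ) (x : H) :
    (rankOneSelf (c • x) : H →L[ℂ] H) = ((‖c‖ ^ 2 : ℝ) : ℂ) • (rankOneSelf x : H →L[ℂ] H) := by
  ext z
  simp only [rankOneSelf_apply, smul_apply, inner_smul_left, smul_smul]
  congr 1
  rw [← Complex.normSq_eq_norm_sq, ← Complex.mul_conj]
  ring

theorem rankOneSelf_mul_self {x : H} (hx : ‖x‖ = 1) :
    (rankOneSelf x : H →L[ℂ] H) * rankOneSelf x = rankOneSelf x :=
  InnerProductSpace.isIdempotentElem_rankOne_self hx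

/-- A self-adjoint projection commuting with `rankOneSelf x` contains or annihilates `x`. -/
theorem projection_apply_eq {E : selfAdjoint (H →L[ℂ] H)} (hE : (E : H →L[ℂ] H) * E = E) {x : H}
    (h : Comm E (rankOneSelf x)) : (E : H →L[ℂ] H) x = 0 ∨ (E : H →L[ℂ] H) x = x := by
  obtain ⟨c, hc⟩ := apply_eq_smul_of_commute h
  have h1 : (E : H →L[ℂ] H) ((E : H →L[ℂ] H) x) = (E : H →L[ℂ] H) x := DFunLike.congr_fun hE x
  rw [hc, map_smul, hc, smul_smul] at h1
  by_cases hx : x = 0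
  · simp [hx]
  have h2 : c * c = c := smul_left_injective ℂ hx h1
  rcases IsIdempotentElem.iff_eq_zero_or_one.mp h2 with h | h
  · left; rw [hc, h, zero_smul]
  · right; rw [hc, h, one_smul]

theorem one_sub_projection {E : selfAdjoint (H →L[ℂ] H)} (hE : (E : H →L[ℂ] H) * E = E) :
    ((1 - E : selfAdjoint (H →L[ℂ] H)) : H →L[ℂ] H) *
      ((1 - E : selfAdjoint (H →L[ℂ] H)) : H →L[ℂ] H) = (1 - E : selfAdjoint (H →L[ℂ] H)) :=
  IsIdempotentElem.one_sub hE

theorem coe_one_sub_apply (E : selfAdjoint (H →L[ℂ] H)) (x : H) :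
    ((1 - E : selfAdjoint (H →L[ℂ] H)) : H →L[ℂ] H) x = x - (E : H →L[ℂ] H) x := rfl

/-- An operator with a maximal commutant that commutes with `rankOneSelf x` is an affine function
of a projection annihilating `x`. -/
theorem HasMaximalCommutant.exists_projection_apply_eq_zero {A : selfAdjoint (H →L[ℂ] H)}
    (hA : HasMaximalCommutant Comm A) {x : H} (h : Comm A (rankOneSelf x)) :
    ∃ (E : selfAdjoint (H →L[ℂ] H)) (a b : ℝ), (E : H →L[ℂ] H) * E = E ∧ a ≠ 0 ∧
      (E : H →L[ℂ] H) x = 0 ∧ (A : H →L[ℂ] H) = (a : ℂ) • (E : H →L[ℂ] H) + (b : ℂ) • 1 := by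
  obtain ⟨E, a, b, hE, ha, hAE⟩ := hA.exists_projection
  have hEx : Comm E (rankOneSelf x) := by
    unfold Comm at h ⊢
    rwa [hAE, commute_smul_add_iff (by exact_mod_cast ha)] at h
  rcases projection_apply_eq hE hEx with h0 | h1
  · exact ⟨E, a, b, hE, ha, h0, hAE⟩
  -- If `E` fixes `x`, its complement annihilates it, and `a E + b = -a (1 - E) + (a + b)`.
  · refine ⟨1 - E, -a, a + b, one_sub_projection hE, neg_ne_zero.mpr ha, ?_, ?_⟩
    · rw [coe_one_sub_apply, h1, sub_self]
    · rw [hAE]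
      ext z
      simp only [add_apply, smul_apply, coe_one_sub_apply, one_apply_eq_self]
      push_cast
      module

/-- If `E` annihilates `x` and `R` commutes with everything that commutes with the projections
`rankOneSelf x` and `E`, then `R` is scalar on the three blocks. -/
theorem eq_of_bicommutant {x : H} (hx : ‖x‖ = 1) {E R : selfAdjoint (H →L[ℂ] H)}
    (hE : (E : H →L[ℂ] H) * E = E) (hEx : (E : H →L[ℂ] H) x = 0)
    (hR : ∀ T, Comm (rankOneSelf x) T → Comm E T → Comm R T) :
    ∃ p q s : ℂ, (R : H →L[ℂ] H) =
      (p - s) • (rankOneSelf x : H →L[ℂ] H) + (q - s) • (E : H →L[ℂ] H) + s • 1 := by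
  have hxx : ⟪x, x⟫_ℂ = 1 := by rw [inner_self_eq_norm_sq_to_K, hx]; simp
  have hEE : ∀ z, (E : H →L[ℂ] H) ((E : H →L[ℂ] H) z) = (E : H →L[ℂ] H) z :=
    fun z => DFunLike.congr_fun hE z
  have hxE : ∀ z, ⟪x, (E : H →L[ℂ] H) z⟫_ℂ = 0 := fun z => by
    rw [← inner_apply_left_of_selfAdjoint E.2, hEx, inner_zero_left]
  have key : ∀ (k l : ℂ) (y : H), ⟪x, y⟫_ℂ • x = l • y → (E : H →L[ℂ] H) y = k • y →
      ∃ c : ℂ, (R : H →L[ℂ] H) y = c • y := fun k l y hl hk =>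
    apply_eq_smul_of_commute (hR (rankOneSelf y)
      (commute_of_apply_eq_smul (rankOneSelf x).2 (c := l) hl)
      (commute_of_apply_eq_smul E.2 hk))
  obtain ⟨p, hp⟩ := key 0 1 x (by rw [hxx]) (by rw [hEx, zero_smul])
  obtain ⟨q, hq⟩ := exists_eq_smul_of_forall_mem (LinearMap.range (E : H →L[ℂ] H).toLinearMap)
    (R : H →L[ℂ] H) (by
      rintro _ ⟨z, rfl⟩
      refine key 1 0 _ ?_ ?_
      · change ⟪x, (E : H →L[ℂ] H) z⟫_ℂ • x = _
        rw [hxE, zero_smul, zero_smul]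
      · rw [one_smul]; exact hEE z)
  let W : Submodule ℂ H := LinearMap.ker (E : H →L[ℂ] H).toLinearMap ⊓ (ℂ ∙ x)ᗮ
  obtain ⟨s, hs⟩ := exists_eq_smul_of_forall_mem W (R : H →L[ℂ] H) (by
      rintro y ⟨hy1, hy2⟩
      refine key 0 0 y ?_ ?_
      · rw [Submodule.mem_orthogonal_singleton_iff_inner_right.mp hy2, zero_smul, zero_smul]
      · rw [zero_smul]; exact hy1)
  refine ⟨p, q, s, ?_⟩
  ext z
  have h1 := hq _ ⟨z, rfl⟩
  change (R : H →L[ℂ] H) ((E : H →L[ℂ] H) z) = q • (E : H →L[ℂ] H) z at h1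
  have h2 := hs (z - ⟪x, z⟫_ℂ • x - (E : H →L[ℂ] H) z) (by
    refine ⟨?_, ?_⟩
    · change (E : H →L[ℂ] H) (z - ⟪x, z⟫_ℂ • x - (E : H →L[ℂ] H) z) = 0
      rw [map_sub, map_sub, map_smul, hEx, hEE, smul_zero, sub_zero, sub_self]
    · rw [SetLike.mem_coe, Submodule.mem_orthogonal_singleton_iff_inner_right, inner_sub_right,
        inner_sub_right, inner_smul_right, hxx, hxE, mul_one, sub_self, sub_zero])
  rw [map_sub, map_sub, map_smul, hp, h1] at h2
  rw [eq_add_of_sub_eq (eq_add_of_sub_eq h2)]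
  simp only [add_apply, smul_apply, rankOneSelf_apply, one_apply_eq_self]
  module

theorem not_isCentralFor_rankOneSelf {x y : H} (hx : x ≠ 0) (hy : y ≠ 0) (hxy : ⟪x, y⟫_ℂ = 0) :
    ¬ IsCentralFor Comm (rankOneSelf x) := by
  intro h
  have h1 := DFunLike.congr_fun (h (rankTwoSwap x y)).eq x
  simp only [mul_apply_eq_comp, rankTwoSwap_apply, rankOneSelf_apply, inner_eq_zero_symm.mp hxy,
    zero_smul, zero_add, map_smul, hxy, smul_zero] at h1
  have := h1.symm
  simp [hx, hy] at this

/-- A projection `E` commuting with `x ⊗ x` can be taken to annihilate `x`. An `R` in the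
bicommutant of the pair is then scalar on three blocks: the line of `x`, the range of `E`, and the
rest. Unless `R` is already in the bicommutant of `x ⊗ x`, it separates the last two blocks, so `E`
is recovered from `x ⊗ x` and `R`. -/
theorem isAtomic_rankOneSelf_of_norm_eq_one {x y : H} (hx : ‖x‖ = 1) (hy : y ≠ 0)
    (hxy : ⟪x, y⟫_ℂ = 0) : IsAtomic Comm (rankOneSelf x) := by
  have hx0 : x ≠ 0 := by rintro rfl; simp at hx
  refine ⟨hasMaximalCommutant_of_projection (rankOneSelf_mul_self hx)
    (not_isCentralFor_rankOneSelf hx0 hy hxy), fun Q R hQ hPQ hR hPR T hPT hRT => ?_⟩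
  obtain ⟨E, a, b, hE, ha, hEx, hQE⟩ := hQ.exists_projection_apply_eq_zero hPQ.symm
  have haC : (a : ℂ) ≠ 0 := by exact_mod_cast ha
  have hQE' : ∀ T, Comm Q T ↔ Comm E T := fun T => by
    unfold Comm
    rw [hQE, commute_smul_add_iff haC]
  simp only [hQE'] at hR ⊢
  obtain ⟨p, q, s, hRe⟩ := eq_of_bicommutant hx hE hEx hR
  have hqs : q - s ≠ 0 := by
    intro h
    apply hPR
    intro S hS
    unfold Comm
    rw [hRe, h, zero_smul, add_zero]
    exact (Commute.smul_left hS _).add_left ((Commute.one_left _).smul_left _)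
  have h1 : Commute ((q - s) • (E : H →L[ℂ] H) + s • 1) (T : H →L[ℂ] H) := by
    have h2 := Commute.sub_left hRT (Commute.smul_left hPT (p - s))
    rw [hRe] at h2
    rwa [add_assoc, add_sub_cancel_left] at h2
  exact (commute_smul_add_iff hqs).mp h1

theorem commute_of_coe_eq {A B : selfAdjoint (H →L[ℂ] H)} {a b : ℂ} (ha : a ≠ 0)
    (h : (A : H →L[ℂ] H) = a • (B : H →L[ℂ] H) + b • 1) (T : selfAdjoint (H →L[ℂ] H)) :
    Comm B T ↔ Comm A T := by
  unfold Comm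
  rw [h, commute_smul_add_iff ha]

theorem isAtomic_rankOneSelf
    (hdim : ∀ a b : H, ∃ c : H, c ≠ 0 ∧ ⟪a, c⟫_ℂ = 0 ∧ ⟪b, c⟫_ℂ = 0) {x : H} (hx : x ≠ 0) :
    IsAtomic Comm (rankOneSelf x) := by
  obtain ⟨u, c, hu, hc, rfl⟩ := exists_eq_smul_norm_one hx
  obtain ⟨y, hy, hxy, -⟩ := hdim u u
  refine (isAtomic_rankOneSelf_of_norm_eq_one hu hy hxy).congr (commute_of_coe_eq
    (a := ((‖(c : ℂ)‖ ^ 2 : ℝ) : ℂ)) (b := 0) ?_ ?_)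
  · simp [hc]
  · rw [rankOneSelf_smul, zero_smul, add_zero]

/-- The range of a nonzero projection is spanned by a unit vector or contains two nonzero
orthogonal vectors. -/
theorem projection_eq_rankOneSelf_or {P : selfAdjoint (H →L[ℂ] H)}
    (hP : (P : H →L[ℂ] H) * P = P) (h0 : (P : H →L[ℂ] H) ≠ 0) :
    ∃ x : H, ‖x‖ = 1 ∧ (P : H →L[ℂ] H) x = x ∧ (P = rankOneSelf x ∨
      ∃ y : H, y ≠ 0 ∧ ⟪x, y⟫_ℂ = 0 ∧ (P : H →L[ℂ] H) y = y) := by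
  have hPP : ∀ z, (P : H →L[ℂ] H) ((P : H →L[ℂ] H) z) = (P : H →L[ℂ] H) z :=
    fun z => DFunLike.congr_fun hP z
  obtain ⟨z₀, hz₀⟩ : ∃ z, (P : H →L[ℂ] H) z ≠ 0 := by
    by_contra! h
    exact h0 (ContinuousLinearMap.ext h)
  obtain ⟨x, c, hx, hc, hxc⟩ := exists_eq_smul_norm_one hz₀
  have hcC : (c : ℂ) ≠ 0 := by exact_mod_cast hc
  have hPx : (P : H →L[ℂ] H) x = x := by
    have h1 : x = (c : ℂ)⁻¹ • (P : H →L[ℂ] H) z₀ := by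
      rw [hxc, smul_smul, inv_mul_cancel₀ hcC, one_smul]
    rw [h1, map_smul, hPP]
  have hxx : ⟪x, x⟫_ℂ = 1 := by rw [inner_self_eq_norm_sq_to_K, hx]; simp
  refine ⟨x, hx, hPx, ?_⟩
  by_contra! h
  obtain ⟨h1, h2⟩ := h
  apply h1
  refine Subtype.ext (ContinuousLinearMap.ext fun z => ?_)
  rw [rankOneSelf_apply, ← sub_eq_zero]
  by_contra h3
  refine h2 _ h3 ?_ ?_
  · rw [inner_sub_right, inner_smul_right, hxx, mul_one, ← inner_apply_left_of_selfAdjoint P.2,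
      hPx, sub_self]
  · rw [map_sub, map_smul, hPP, hPx]

/-- A projection with two orthogonal vectors in its range and in its kernel is not atomic. -/
theorem not_isAtomic_projection {P : selfAdjoint (H →L[ℂ] H)} {x y u v : H} (hx : ‖x‖ = 1)
    (hPx : (P : H →L[ℂ] H) x = x) (hy : y ≠ 0) (hxy : ⟪x, y⟫_ℂ = 0)
    (hPy : (P : H →L[ℂ] H) y = y) (hu : ‖u‖ = 1) (hPu : (P : H →L[ℂ] H) u = 0) (hv : v ≠ 0)
    (huv : ⟪u, v⟫_ℂ = 0) (hPv : (P : H →L[ℂ] H) v = 0) : ¬ IsAtomic Comm P := by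
  intro hP
  have hxx : ⟪x, x⟫_ℂ = 1 := by rw [inner_self_eq_norm_sq_to_K, hx]; simp
  have huu : ⟪u, u⟫_ℂ = 1 := by rw [inner_self_eq_norm_sq_to_K, hu]; simp
  have h01 : ∀ {a b : H}, (P : H →L[ℂ] H) a = a → (P : H →L[ℂ] H) b = 0 → ⟪a, b⟫_ℂ = 0 :=
    fun {a b} ha hb => by
      rw [← ha, inner_apply_left_of_selfAdjoint P.2, hb, inner_zero_right]
  have hxu := h01 hPx hPu
  have hxv := h01 hPx hPv
  have hux := inner_eq_zero_symm.mp hxu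
  have hvx := inner_eq_zero_symm.mp hxv
  have hvu := inner_eq_zero_symm.mp huv
  have hyx := inner_eq_zero_symm.mp hxy
  let Q : selfAdjoint (H →L[ℂ] H) := rankOneSelf x + rankOneSelf u
  have hQapp : ∀ z, (Q : H →L[ℂ] H) z = ⟪x, z⟫_ℂ • x + ⟪u, z⟫_ℂ • u := fun z => rfl
  have hQQ : (Q : H →L[ℂ] H) * Q = Q := by
    refine ContinuousLinearMap.ext fun z => ?_
    rw [mul_apply_eq_comp, hQapp, hQapp]
    simp only [inner_add_right, inner_smul_right, hxx, huu, hxu, hux]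
    simp
  have hB : ¬ Comm Q (rankTwoSwap u v) := by
    intro h
    have h1 := DFunLike.congr_fun h.eq u
    simp only [mul_apply_eq_comp, hQapp, rankTwoSwap_apply, inner_add_right, inner_smul_right,
      hux, hxu, huv, hvu, hvx, hxv, huu] at h1
    simp at h1
    exact hv h1.symm
  have hPx' : Comm P (rankOneSelf x) :=
    commute_of_apply_eq_smul P.2 (c := 1) (by rw [hPx, one_smul])
  have hPu' : Comm P (rankOneSelf u) :=
    commute_of_apply_eq_smul P.2 (c := 0) (by rw [hPu, zero_smul])
  refine hB (hP.2 Q (rankOneSelf x)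
    (hasMaximalCommutant_of_projection hQQ fun h => hB (h _)) (Commute.add_right hPx' hPu')
    ?_ ?_ (rankTwoSwap u v) ?_ ?_)
  · intro T hPT hQT
    have h1 : (rankOneSelf x : H →L[ℂ] H) = (P : H →L[ℂ] H) * (Q : H →L[ℂ] H) := by
      ext z
      rw [mul_apply_eq_comp, hQapp, map_add, map_smul, map_smul, hPx, hPu, smul_zero, add_zero,
        rankOneSelf_apply]
    unfold Comm
    rw [h1]
    exact Commute.mul_left hPT hQT
  · intro h
    have h1 := DFunLike.congr_fun (h (rankTwoSwap x y) (commute_rankTwoSwap (c := 1) P.2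
      (by rw [hPx, Complex.ofReal_one, one_smul]) (by rw [hPy, Complex.ofReal_one, one_smul]))).eq x
    simp only [mul_apply_eq_comp, rankOneSelf_apply, rankTwoSwap_apply, inner_add_right,
      inner_smul_right, hxx, hxy, hyx] at h1
    simp at h1
    exact hy h1.symm
  · exact commute_rankTwoSwap (c := 0) P.2 (by simp [hPu]) (by simp [hPv])
  · exact commute_rankTwoSwap (c := 0) (rankOneSelf x).2 (by simp [hxu]) (by simp [hxv])

/-- The underlying projection is neither 0 nor 1, and `not_isAtomic_projection` excludes that range
and kernel both have dimension at least two. Corank one is absorbed into a change of the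
coefficients. -/
theorem IsAtomic.exists_rankOneSelf {A : selfAdjoint (H →L[ℂ] H)} (hA : IsAtomic Comm A) :
    ∃ (x : H) (a b : ℝ), x ≠ 0 ∧ a ≠ 0 ∧
      (A : H →L[ℂ] H) = (a : ℂ) • (rankOneSelf x : H →L[ℂ] H) + (b : ℂ) • 1 := by
  obtain ⟨P, a, b, hP, ha, hAP⟩ := hA.1.exists_projection
  have haC : (a : ℂ) ≠ 0 := by exact_mod_cast ha
  have hPA := commute_of_coe_eq haC hAP
  have hPat : IsAtomic Comm P := hA.congr fun T => (hPA T).symm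
  have hP0 : (P : H →L[ℂ] H) ≠ 0 := fun h => hPat.1.1 fun T => by
    unfold Comm; rw [h]; exact Commute.zero_left _
  have hP1 : ((1 - P : selfAdjoint (H →L[ℂ] H)) : H →L[ℂ] H) ≠ 0 := fun h => hPat.1.1 fun T => by
    have h1 : (P : H →L[ℂ] H) = 1 := (sub_eq_zero.mp h).symm
    unfold Comm; rw [h1]; exact Commute.one_left _
  obtain ⟨x, hx, hPx, rfl | ⟨y, hy, hxy, hPy⟩⟩ := projection_eq_rankOneSelf_or hP hP0
  · exact ⟨x, a, b, by rintro rfl; simp at hx, ha, hAP⟩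
  obtain ⟨u, hu, hPu, h | ⟨v, hv, huv, hPv⟩⟩ :=
    projection_eq_rankOneSelf_or (one_sub_projection hP) hP1
  · refine ⟨u, -a, a + b, by rintro rfl; simp at hu, neg_ne_zero.mpr ha, ?_⟩
    rw [← h, hAP]
    ext z
    simp only [add_apply, smul_apply, coe_one_sub_apply, one_apply_eq_self]
    push_cast
    module
  · rw [coe_one_sub_apply, sub_eq_self] at hPu hPv
    exact absurd hPat (not_isAtomic_projection hx hPx hy hxy hPy hu hPu hv huv hPv)

end RankOne


/-! ### Numerical radius of commutators with rank one operators -/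

section NumericalRadius

variable {H : Type*} [NormedAddCommGroup H] [InnerProductSpace ℂ H]

/-- No linearity is asked of `V`, so that unitaries and antilinear conjugations are both covered. -/
theorem numericalRadius_eq_of_equiv {T T' : H →L[ℂ] H} (V : H ≃ H) (hV : ∀ x, ‖V x‖ = ‖x‖)
    (h : ∀ x, ‖⟪x, T x⟫_ℂ‖ = ‖⟪V x, T' (V x)⟫_ℂ‖) : numericalRadius T = numericalRadius T' := by
  unfold numericalRadius
  congr 1
  ext r
  constructor
  · rintro ⟨_, ⟨x, hx, rfl⟩, rfl⟩
    exact ⟨_, ⟨V x, by rw [hV, hx], rfl⟩, (h x).symm⟩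
  · rintro ⟨_, ⟨x, hx, rfl⟩, rfl⟩
    refine ⟨_, ⟨V.symm x, by rw [← hV, V.apply_symm_apply, hx], rfl⟩, ?_⟩
    simp only [h, V.apply_symm_apply]

open scoped Pointwise in
theorem numericalRadius_smul (c : ℂ) (T : H →L[ℂ] H) :
    numericalRadius (c • T) = ‖c‖ * numericalRadius T := by
  unfold numericalRadius
  rw [← smul_eq_mul, ← Real.sSup_smul_of_nonneg (norm_nonneg c)]
  congr 1
  ext r
  simp only [numericalRange, Set.mem_image, Set.mem_ofPred_eq, Set.mem_smul_set]
  constructor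
  · rintro ⟨_, ⟨x, hx, rfl⟩, rfl⟩
    exact ⟨_, ⟨_, ⟨x, hx, rfl⟩, rfl⟩, by simp⟩
  · rintro ⟨_, ⟨_, ⟨x, hx, rfl⟩, rfl⟩, rfl⟩
    exact ⟨_, ⟨x, hx, rfl⟩, by simp⟩

theorem norm_inner_le_numericalRadius (T : H →L[ℂ] H) {x : H} (hx : ‖x‖ = 1) :
    ‖⟪x, T x⟫_ℂ‖ ≤ numericalRadius T := by
  refine le_csSup ⟨‖T‖, ?_⟩ ⟨_, ⟨x, hx, rfl⟩, rfl⟩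
  rintro _ ⟨_, ⟨y, hy, rfl⟩, rfl⟩
  calc ‖⟪y, T y⟫_ℂ‖ ≤ ‖y‖ * ‖T y‖ := norm_inner_le_norm _ _
    _ ≤ ‖y‖ * (‖T‖ * ‖y‖) := by gcongr; exact T.le_opNorm y
    _ = ‖T‖ := by rw [hy]; ring

theorem numericalRadius_le {T : H →L[ℂ] H} {r : ℝ} (hr : 0 ≤ r)
    (h : ∀ x, ‖x‖ = 1 → ‖⟪x, T x⟫_ℂ‖ ≤ r) : numericalRadius T ≤ r := by
  refine Real.sSup_le ?_ hr
  rintro _ ⟨_, ⟨x, hx, rfl⟩, rfl⟩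
  exact h x hx

theorem numericalRadius_eq_zero_iff {T : H →L[ℂ] H} : numericalRadius T = 0 ↔ T = 0 := by
  constructor
  · intro h
    have h0 : ∀ x, ⟪(T : H →ₗ[ℂ] H) x, x⟫_ℂ = 0 := by
      intro x
      by_cases hx : x = 0
      · simp [hx]
      obtain ⟨u, c, hu, -, rfl⟩ := exists_eq_smul_norm_one hx
      have h1 := norm_inner_le_numericalRadius T hu
      rw [h, norm_le_zero_iff] at h1
      have h2 : ⟪T u, u⟫_ℂ = 0 := inner_eq_zero_symm.mp h1
      simp [h2]
    have h1 := (inner_map_self_eq_zero (T : H →ₗ[ℂ] H)).mp h0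
    exact ContinuousLinearMap.ext fun x => LinearMap.congr_fun h1 x
  · rintro rfl
    exact le_antisymm (numericalRadius_le le_rfl fun x _ => by simp)
      (Real.sSup_nonneg (by rintro _ ⟨z, -, rfl⟩; exact norm_nonneg z))

theorem norm_sq_eq_of_inner_self {z : H} {r : ℝ} (h : ⟪z, z⟫_ℂ = (r : ℂ)) : ‖z‖ ^ 2 = r := by
  rw [← inner_self_eq_norm_sq (𝕜 := ℂ), h]
  rfl

/-- Bessel's inequality for two orthonormal vectors: the residual of `z` has nonnegative squared
norm. -/
theorem norm_inner_sq_add_le {x v : H} (hx : ‖x‖ = 1) (hv : ‖v‖ = 1) (hxv : ⟪x, v⟫_ℂ = 0)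
    (z : H) : ‖⟪x, z⟫_ℂ‖ ^ 2 + ‖⟪v, z⟫_ℂ‖ ^ 2 ≤ ‖z‖ ^ 2 := by
  have hxx : ⟪x, x⟫_ℂ = 1 := by rw [inner_self_eq_norm_sq_to_K, hx]; simp
  have hvv : ⟪v, v⟫_ℂ = 1 := by rw [inner_self_eq_norm_sq_to_K, hv]; simp
  have hvx := inner_eq_zero_symm.mp hxv
  have h1 : ⟪z - ⟪x, z⟫_ℂ • x - ⟪v, z⟫_ℂ • v, z - ⟪x, z⟫_ℂ • x - ⟪v, z⟫_ℂ • v⟫_ℂ =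
      ((‖z‖ ^ 2 - ‖⟪x, z⟫_ℂ‖ ^ 2 - ‖⟪v, z⟫_ℂ‖ ^ 2 : ℝ) : ℂ) := by
    simp only [inner_sub_left, inner_sub_right, inner_smul_left, inner_smul_right, hxx, hvv, hxv,
      hvx, ← inner_conj_symm z x, ← inner_conj_symm z v, inner_self_eq_norm_sq_to_K z]
    push_cast
    rw [← Complex.conj_mul' ⟪x, z⟫_ℂ, ← Complex.conj_mul' ⟪v, z⟫_ℂ]
    simp only [Complex.coe_algebraMap]
    ring
  linarith [norm_sq_eq_of_inner_self h1, sq_nonneg ‖z - ⟪x, z⟫_ℂ • x - ⟪v, z⟫_ℂ • v‖]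

theorem numericalRadius_rankOne_sub_of_norm_one {x v : H} (hx : ‖x‖ = 1) (hv : ‖v‖ = 1)
    (hxv : ⟪x, v⟫_ℂ = 0) :
    numericalRadius (InnerProductSpace.rankOne ℂ v x - InnerProductSpace.rankOne ℂ x v) = 1 := by
  have hxx : ⟪x, x⟫_ℂ = 1 := by rw [inner_self_eq_norm_sq_to_K, hx]; simp
  have hvv : ⟪v, v⟫_ℂ = 1 := by rw [inner_self_eq_norm_sq_to_K, hv]; simp
  have hvx := inner_eq_zero_symm.mp hxv
  have key : ∀ z : H, ⟪z, (InnerProductSpace.rankOne ℂ v x - InnerProductSpace.rankOne ℂ x v) z⟫_ℂ =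
      ⟪x, z⟫_ℂ * ⟪z, v⟫_ℂ - ⟪v, z⟫_ℂ * ⟪z, x⟫_ℂ := fun z => by
    rw [sub_apply, InnerProductSpace.rankOne_apply, InnerProductSpace.rankOne_apply,
      inner_sub_right, inner_smul_right, inner_smul_right]
  apply le_antisymm
  · refine numericalRadius_le zero_le_one fun z hz => ?_
    have h1 := norm_inner_sq_add_le hx hv hxv z
    rw [key]
    refine (norm_sub_le _ _).trans ?_
    rw [norm_mul, norm_mul, norm_inner_symm z v, norm_inner_symm z x]
    rw [hz] at h1
    nlinarith [sq_nonneg (‖⟪x, z⟫_ℂ‖ - ‖⟪v, z⟫_ℂ‖)]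
  · set s : ℝ := (√2)⁻¹ with hs
    have hs2 : s * s = 1 / 2 := by
      rw [hs, ← mul_inv, Real.mul_self_sqrt (by norm_num)]; norm_num
    have hs2C : (s : ℂ) * s = 1 / 2 := by rw [← Complex.ofReal_mul, hs2]; norm_num
    -- The quadratic form is `2i Im (⟪x, z⟫ ⟪z, v⟫)`. The factor `I` makes this product purely
    -- imaginary, and equal weights on `x` and `v` make it largest.
    set z : H := (s : ℂ) • (x + Complex.I • v) with hzdef
    have hz : ‖z‖ = 1 := by
      have h1 : ⟪z, z⟫_ℂ = 1 := by
        simp only [hzdef, inner_smul_left, inner_smul_right, inner_add_left, inner_add_right, hxx,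
          hvv, hxv, hvx, Complex.conj_ofReal, Complex.conj_I]
        linear_combination (1 - Complex.I * Complex.I) * hs2C - (1 / 2) * Complex.I_mul_I
      have h2 : ‖z‖ ^ 2 = 1 := norm_sq_eq_of_inner_self (by rw [h1, Complex.ofReal_one])
      exact (pow_eq_one_iff_of_nonneg (norm_nonneg z) two_ne_zero).mp h2
    have h1 := norm_inner_le_numericalRadius
      (InnerProductSpace.rankOne ℂ v x - InnerProductSpace.rankOne ℂ x v) hz
    rw [key] at h1
    have h2 : ⟪x, z⟫_ℂ * ⟪z, v⟫_ℂ - ⟪v, z⟫_ℂ * ⟪z, x⟫_ℂ = -Complex.I := by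
      simp only [hzdef, inner_smul_left, inner_smul_right, inner_add_left, inner_add_right, hxx,
          hvv, hxv, hvx, Complex.conj_ofReal, Complex.conj_I]
      linear_combination (-2 * Complex.I) * hs2C
    rwa [h2, norm_neg, Complex.norm_I] at h1

theorem numericalRadius_rankOne_sub {x v : H} (hxv : ⟪x, v⟫_ℂ = 0) :
    numericalRadius (InnerProductSpace.rankOne ℂ v x - InnerProductSpace.rankOne ℂ x v) =
      ‖v‖ * ‖x‖ := by
  by_cases hx0 : x = 0
  · simp [hx0, numericalRadius_eq_zero_iff]
  by_cases hv0 : v = 0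
  · simp [hv0, numericalRadius_eq_zero_iff]
  obtain ⟨x, a, hx, ha, rfl⟩ := exists_eq_smul_norm_one hx0
  obtain ⟨v, b, hv, hb, rfl⟩ := exists_eq_smul_norm_one hv0
  have hxv' : ⟪x, v⟫_ℂ = 0 := by
    simpa [inner_smul_left, inner_smul_right, ha, hb] using hxv
  have h1 : InnerProductSpace.rankOne ℂ ((b : ℂ) • v) ((a : ℂ) • x) -
      InnerProductSpace.rankOne ℂ ((a : ℂ) • x) ((b : ℂ) • v) = ((b : ℂ) * (a : ℂ)) •
        (InnerProductSpace.rankOne ℂ v x - InnerProductSpace.rankOne ℂ x v) := by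
    ext z
    simp only [sub_apply, smul_apply, InnerProductSpace.rankOne_apply, inner_smul_left,
      Complex.conj_ofReal]
    module
  rw [h1, numericalRadius_smul, numericalRadius_rankOne_sub_of_norm_one hx hv hxv', norm_mul,
    norm_smul, norm_smul, hx, hv, mul_one, mul_one, mul_one]

/-- The unnormalised variance of `A` in the state given by `x`. -/
def variance (A : H →L[ℂ] H) (x : H) : ℝ := ‖A x‖ ^ 2 * ‖x‖ ^ 2 - (⟪x, A x⟫_ℂ).re ^ 2

variable [CompleteSpace H]

theorem ofReal_re_inner_apply_self {A : H →L[ℂ] H} (hA : IsSelfAdjoint A) (x : H) :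
    (((⟪x, A x⟫_ℂ).re : ℝ) : ℂ) = ⟪x, A x⟫_ℂ := by
  rw [← Complex.conj_eq_iff_re, inner_conj_symm, inner_apply_left_of_selfAdjoint hA]

/-- Only the component `v` of `A x` orthogonal to `x` survives in the commutator, which is `v ⊗ x -
x ⊗ v` with numerical radius `‖v‖ ‖x‖`; Pythagoras turns its square into the variance. -/
theorem numericalRadius_commutator_rankOneSelf {A : H →L[ℂ] H} (hA : IsSelfAdjoint A) (x : H) :
    numericalRadius (A * (rankOneSelf x : H →L[ℂ] H) - (rankOneSelf x : H →L[ℂ] H) * A) ^ 2 =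
      variance A x := by
  by_cases hx : x = 0
  · have : (rankOneSelf x : H →L[ℂ] H) = 0 := by ext z; simp [hx]
    rw [this, mul_zero, zero_mul, sub_zero, numericalRadius_eq_zero_iff.mpr rfl]
    simp [variance, hx]
  have hn : ‖x‖ ≠ 0 := norm_ne_zero_iff.mpr hx
  have hnC : (‖x‖ : ℂ) ≠ 0 := by exact_mod_cast hn
  set a : ℝ := (⟪x, A x⟫_ℂ).re / ‖x‖ ^ 2 with ha
  have haA : ⟪x, A x⟫_ℂ = a * (‖x‖ : ℂ) ^ 2 := by
    rw [← ofReal_re_inner_apply_self hA, ha]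
    push_cast
    field_simp
  set v : H := A x - (a : ℂ) • x with hv
  have hAx : A x = (a : ℂ) • x + v := by rw [hv]; abel
  have hxv : ⟪x, v⟫_ℂ = 0 := by
    rw [hv, inner_sub_right, inner_smul_right, haA, inner_self_eq_norm_sq_to_K]
    exact sub_self _
  have hcomm : A * (rankOneSelf x : H →L[ℂ] H) - (rankOneSelf x : H →L[ℂ] H) * A =
      InnerProductSpace.rankOne ℂ v x - InnerProductSpace.rankOne ℂ x v := by
    ext z
    simp only [sub_apply, mul_apply_eq_comp, InnerProductSpace.rankOne_apply, rankOneSelf_apply,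
      map_smul, ← inner_apply_left_of_selfAdjoint hA, hAx, inner_add_left, inner_smul_left,
      Complex.conj_ofReal]
    module
  rw [hcomm, numericalRadius_rankOne_sub hxv]
  have h1 : ‖A x‖ ^ 2 = a ^ 2 * ‖x‖ ^ 2 + ‖v‖ ^ 2 := by
    have h2 := norm_add_sq_eq_norm_sq_add_norm_sq_of_inner_eq_zero ((a : ℂ) • x) v
      (by rw [inner_smul_left, hxv, mul_zero])
    rw [← hAx, norm_smul, Complex.norm_real, Real.norm_eq_abs] at h2
    nlinarith [sq_abs a]
  have h3 : (⟪x, A x⟫_ℂ).re = a * ‖x‖ ^ 2 := by rw [ha]; field_simp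
  rw [variance, h1, h3]
  ring

end NumericalRadius

/-! ### Variances determine an operator up to sign and a real scalar -/

section Variance

variable {H : Type*} [NormedAddCommGroup H] [InnerProductSpace ℂ H]

/-- For independent `p` and `q`, comparing coefficients in the third eigenvector forces equal
eigenvalues, so `T` is scalar on the plane. -/
theorem exists_smul_of_three_eigenvectors {T : H →L[ℂ] H} {p q : H} {a b : ℂ}
    (hb : b ≠ 0) (ha : a ≠ 0) (hp : ∃ c : ℂ, T p = c • p) (hq : ∃ c : ℂ, T q = c • q)
    (hpq : ∃ c : ℂ, T (a • p + b • q) = c • (a • p + b • q)) (a' b' : ℂ) :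
    ∃ c : ℂ, T (a' • p + b' • q) = c • (a' • p + b' • q) := by
  obtain ⟨k, hk⟩ := hp
  obtain ⟨l, hl⟩ := hq
  obtain ⟨m, hm⟩ := hpq
  by_cases hpar : ∃ c : ℂ, q = c • p
  · obtain ⟨c, rfl⟩ := hpar
    refine ⟨k, ?_⟩
    simp only [map_add, map_smul, hk]
    module
  rw [map_add, map_smul, map_smul, hk, hl] at hm
  have h1 : (b * (l - m)) • q = (a * (m - k)) • p := by
    rw [← sub_eq_zero] at hm ⊢
    rw [← hm]
    module
  by_cases hlm : b * (l - m) = 0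
  · rw [hlm, zero_smul] at h1
    have hlm' : l = m := sub_eq_zero.mp ((mul_eq_zero.mp hlm).resolve_left hb)
    rcases smul_eq_zero.mp h1.symm with h2 | h2
    · have hkm : m = k := sub_eq_zero.mp ((mul_eq_zero.mp h2).resolve_left ha)
      refine ⟨m, ?_⟩
      rw [map_add, map_smul, map_smul, hk, hl, hlm', hkm]
      module
    · refine ⟨l, ?_⟩
      rw [map_add, map_smul, map_smul, hl, h2, map_zero]
      module
  · refine absurd ⟨(b * (l - m))⁻¹ * (a * (m - k)), ?_⟩ hpar
    rw [mul_smul, ← h1, smul_smul, inv_mul_cancel₀ hlm, one_smul]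

/-- If every vector is an eigenvector of one of two operators, then one of the operators has only
eigenvectors. -/
theorem forall_eigenvector_or {C D : H →L[ℂ] H}
    (h : ∀ x, (∃ c : ℂ, C x = c • x) ∨ ∃ c : ℂ, D x = c • x) :
    (∀ x, ∃ c : ℂ, C x = c • x) ∨ ∀ x, ∃ c : ℂ, D x = c • x := by
  by_contra hcon
  rw [not_or, not_forall, not_forall] at hcon
  obtain ⟨⟨u, hu⟩, ⟨w, hw⟩⟩ := hcon
  have huD := (h u).resolve_left hu
  have hwC := (h w).resolve_right hw
  have hC : ∀ t s : ℂ, t ≠ s → (∃ c : ℂ, C (u + t • w) = c • (u + t • w)) →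
      ¬ ∃ c : ℂ, C (u + s • w) = c • (u + s • w) := by
    intro t s hts h1 h2
    have hts' : t - s ≠ 0 := sub_ne_zero.mpr hts
    have e1 : (t - s)⁻¹ • (u + t • w) + (-(t - s)⁻¹) • (u + s • w) = w := by
      rw [neg_smul, ← smul_neg, ← smul_add, inv_smul_eq_iff₀ hts']
      module
    have e2 : (-(t - s)⁻¹ * s) • (u + t • w) + ((t - s)⁻¹ * t) • (u + s • w) = u := by
      rw [neg_mul, neg_smul, mul_smul, mul_smul, ← smul_neg, ← smul_add, inv_smul_eq_iff₀ hts']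
      module
    have := exists_smul_of_three_eigenvectors (neg_ne_zero.mpr (inv_ne_zero hts'))
      (inv_ne_zero hts') h1 h2 (by rw [e1]; exact hwC) (-(t - s)⁻¹ * s) ((t - s)⁻¹ * t)
    rw [e2] at this
    exact hu this
  have hD : ∀ t s : ℂ, t ≠ 0 → s ≠ 0 → t ≠ s → (∃ c : ℂ, D (u + t • w) = c • (u + t • w)) →
      ¬ ∃ c : ℂ, D (u + s • w) = c • (u + s • w) := by
    intro t s ht hs hts h1 h2
    have hts' : t - s ≠ 0 := sub_ne_zero.mpr hts
    have e1 : (t - s)⁻¹ • (u + t • w) + (-(t - s)⁻¹) • (u + s • w) = w := by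
      rw [neg_smul, ← smul_neg, ← smul_add, inv_smul_eq_iff₀ hts']
      module
    have e2 : (-(t - s)⁻¹ * s) • (u + t • w) + ((t - s)⁻¹ * t) • (u + s • w) = u := by
      rw [neg_mul, neg_smul, mul_smul, mul_smul, ← smul_neg, ← smul_add, inv_smul_eq_iff₀ hts']
      module
    have := exists_smul_of_three_eigenvectors (mul_ne_zero (inv_ne_zero hts') ht)
      (mul_ne_zero (neg_ne_zero.mpr (inv_ne_zero hts')) hs) h1 h2 (by rw [e2]; exact huD)
      (t - s)⁻¹ (-(t - s)⁻¹)
    rw [e1] at this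
    exact hw this
  -- Pigeonhole: of three points on the line `u + t w`, two are eigenvectors of the same operator.
  -- With `w` (for `C`) or `u` (for `D`) as third eigenvector, that operator would be scalar on the
  -- plane. The parameter 0 is avoided because it gives `u` itself.
  have h1 := h (u + (1 : ℂ) • w)
  have h2 := h (u + (2 : ℂ) • w)
  have h3 := h (u + (3 : ℂ) • w)
  have c12 := hC 1 2 (by norm_num)
  have c13 := hC 1 3 (by norm_num)
  have c23 := hC 2 3 (by norm_num)
  have d12 := hD 1 2 (by norm_num) (by norm_num) (by norm_num)
  have d13 := hD 1 3 (by norm_num) (by norm_num) (by norm_num)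
  have d23 := hD 2 3 (by norm_num) (by norm_num) (by norm_num)
  rcases h1 with h1 | h1 <;> rcases h2 with h2 | h2 <;> rcases h3 with h3 | h3
  · exact c12 h1 h2
  · exact c12 h1 h2
  · exact c13 h1 h3
  · exact d23 h2 h3
  · exact c23 h2 h3
  · exact d13 h1 h3
  · exact d12 h1 h2
  · exact d12 h1 h2

variable [CompleteSpace H]

theorem variance_add_smul {A : H →L[ℂ] H} (hA : IsSelfAdjoint A) {x y : H} (hxy : ⟪x, y⟫_ℂ = 0)
    {c : ℂ} (hc : ‖c‖ = 1) :
    variance A (x + c • y) =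
      (‖A x‖ ^ 2 + 2 * (c * ⟪A x, A y⟫_ℂ).re + ‖A y‖ ^ 2) * (‖x‖ ^ 2 + ‖y‖ ^ 2) -
        ((⟪x, A x⟫_ℂ).re + (⟪y, A y⟫_ℂ).re + 2 * (c * ⟪x, A y⟫_ℂ).re) ^ 2 := by
  have h1 : ‖A (x + c • y)‖ ^ 2 = ‖A x‖ ^ 2 + 2 * (c * ⟪A x, A y⟫_ℂ).re + ‖A y‖ ^ 2 := by
    rw [map_add, map_smul, norm_add_sq (𝕜 := ℂ), inner_smul_right, norm_smul, hc, one_mul]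
    rfl
  have h2 : ‖x + c • y‖ ^ 2 = ‖x‖ ^ 2 + ‖y‖ ^ 2 := by
    rw [norm_add_sq (𝕜 := ℂ), inner_smul_right, hxy, norm_smul, hc, one_mul]
    simp
  have h3 : (⟪x + c • y, A (x + c • y)⟫_ℂ).re =
      (⟪x, A x⟫_ℂ).re + (⟪y, A y⟫_ℂ).re + 2 * (c * ⟪x, A y⟫_ℂ).re := by
    have h4 : ⟪y, A x⟫_ℂ = starRingEnd ℂ ⟪x, A y⟫_ℂ := by
      rw [inner_conj_symm, inner_apply_left_of_selfAdjoint hA]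
    have h5 : starRingEnd ℂ c * c = 1 := by rw [Complex.conj_mul', hc]; simp
    have h6 : ⟪x + c • y, A (x + c • y)⟫_ℂ = ⟪x, A x⟫_ℂ + ⟪y, A y⟫_ℂ +
        (c * ⟪x, A y⟫_ℂ + starRingEnd ℂ (c * ⟪x, A y⟫_ℂ)) := by
      simp only [map_add, map_smul, inner_add_left, inner_add_right, inner_smul_left,
        inner_smul_right, h4, map_mul]
      linear_combination ⟪y, A y⟫_ℂ * h5
    rw [h6, Complex.add_conj, Complex.add_re, Complex.add_re]
    simp
  rw [variance, h1, h2, h3]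

theorem re_inner_sq_eq_of_variance {A B : H →L[ℂ] H} (hA : IsSelfAdjoint A) (hB : IsSelfAdjoint B)
    (h : ∀ x, variance A x = variance B x) {x y : H} (hxy : ⟪x, y⟫_ℂ = 0) :
    (⟪x, A y⟫_ℂ ^ 2).re = (⟪x, B y⟫_ℂ ^ 2).re := by
  have e1 := h (x + (1 : ℂ) • y)
  have e2 := h (x + (-1 : ℂ) • y)
  have e3 := h (x + Complex.I • y)
  have e4 := h (x + (-Complex.I) • y)
  rw [variance_add_smul hA hxy (by simp), variance_add_smul hB hxy (by simp)] at e1 e2 e3 e4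
  simp only [Complex.mul_re, Complex.neg_re, Complex.neg_im, Complex.one_re, Complex.one_im,
    Complex.I_re, Complex.I_im] at e1 e2 e3 e4
  rw [pow_two, pow_two, Complex.mul_re, Complex.mul_re]
  -- Over the phases 1, -1, i, -i with signs +, +, -, -, the constant and linear terms cancel. The
  -- squares `(2 Re (c k))²` leave `8 Re (k²)`.
  linear_combination (-1 / 8) * (e1 + e2 - e3 - e4)

theorem inner_sq_eq_of_variance {A B : H →L[ℂ] H} (hA : IsSelfAdjoint A) (hB : IsSelfAdjoint B)
    (h : ∀ x, variance A x = variance B x) {x y : H} (hxy : ⟪x, y⟫_ℂ = 0) :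
    ⟪x, A y⟫_ℂ ^ 2 = ⟪x, B y⟫_ℂ ^ 2 := by
  refine Complex.ext (re_inner_sq_eq_of_variance hA hB h hxy) ?_
  -- Since `(1 + i)² = 2i`, the real part for this vector is minus twice the imaginary part wanted.
  have h1 := re_inner_sq_eq_of_variance hA hB h (x := x) (y := (1 + Complex.I) • y)
    (by rw [inner_smul_right, hxy, mul_zero])
  have h2 : ∀ k : ℂ, (((1 + Complex.I) * k) ^ 2).re = -2 * (k ^ 2).im := fun k => by
    simp [pow_two]
    ring
  rw [map_smul, map_smul, inner_smul_right, inner_smul_right, h2, h2] at h1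
  linarith

/-- The variances determine a self-adjoint operator up to a sign and an additive real constant. -/
theorem eq_smul_add_of_variance {A B : H →L[ℂ] H} (hA : IsSelfAdjoint A) (hB : IsSelfAdjoint B)
    (h : ∀ x, variance A x = variance B x) :
    ∃ s f : ℝ, (s = 1 ∨ s = -1) ∧ B = (s : ℂ) • A + (f : ℂ) • (1 : H →L[ℂ] H) := by
  have hloc : ∀ x, (∃ c : ℂ, (B - A) x = c • x) ∨ ∃ c : ℂ, (B + A) x = c • x := by
    intro x
    by_contra hcon
    rw [not_or] at hcon
    obtain ⟨h1, h2⟩ := hcon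
    have h1' := mt exists_smul_of_orthogonal h1
    have h2' := mt exists_smul_of_orthogonal h2
    push Not at h1' h2'
    obtain ⟨y, -, hxy, hy⟩ := h1'
    obtain ⟨z, -, hxz, hz⟩ := h2'
    have key : ∀ w, ⟪x, w⟫_ℂ = 0 → ⟪(B - A) x, w⟫_ℂ * ⟪(B + A) x, w⟫_ℂ = 0 := by
      intro w hw
      have h3 := inner_sq_eq_of_variance hA hB h hw
      rw [← inner_apply_left_of_selfAdjoint hA, ← inner_apply_left_of_selfAdjoint hB] at h3
      rw [sub_apply, add_apply, inner_sub_left, inner_add_left]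
      linear_combination -h3
    have hy' := (mul_eq_zero.mp (key y hxy)).resolve_left hy
    have hz' := (mul_eq_zero.mp (key z hxz)).resolve_right hz
    -- Two linear functionals with vanishing product: were both nonzero, their product would be
    -- nonzero at the sum of suitable witnesses.
    have h4 := key (y + z) (by rw [inner_add_right, hxy, hxz, add_zero])
    rw [inner_add_right, inner_add_right, hy', hz', add_zero, zero_add] at h4
    exact mul_ne_zero hy hz h4
  rcases forall_eigenvector_or hloc with h1 | h1
  · obtain ⟨f, hf⟩ := exists_real_smul_one (hB.sub hA) h1
    exact ⟨1, f, Or.inl rfl, by rw [← hf]; simp⟩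
  · obtain ⟨f, hf⟩ := exists_real_smul_one (hB.add hA) h1
    exact ⟨-1, f, Or.inr rfl, by rw [← hf]; simp⟩

end Variance


/-! ### From preserved commutator radii to transported variances -/

section Main

variable {H : Type*} [NormedAddCommGroup H] [InnerProductSpace ℂ H]

theorem exists_orthogonal_pair (hdim : 3 ≤ Module.rank ℂ H) (a b : H) :
    ∃ c : H, c ≠ 0 ∧ ⟪a, c⟫_ℂ = 0 ∧ ⟪b, c⟫_ℂ = 0 := by
  classical
  let V : Submodule ℂ H := Submodule.span ℂ (({a, b} : Finset H) : Set H)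
  have hV : Vᗮ ≠ ⊥ := by
    intro h
    rw [Submodule.orthogonal_eq_bot_iff] at h
    have h1 : Module.rank ℂ V ≤ (2 : ℕ) :=
      (rank_span_finset_le ({a, b} : Finset H)).trans (by exact_mod_cast Finset.card_le_two)
    rw [h, rank_top] at h1
    have h2 : ((3 : ℕ) : Cardinal) ≤ (2 : ℕ) := le_trans (by exact_mod_cast hdim) h1
    norm_num at h2
  obtain ⟨c, hc, hc0⟩ := Submodule.exists_mem_ne_zero_of_ne_bot hV
  rw [Submodule.mem_orthogonal] at hc
  exact ⟨c, hc0, hc a (Submodule.subset_span (by simp)), hc b (Submodule.subset_span (by simp))⟩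

theorem basisConj_basisConj {ι : Type*} (b : HilbertBasis ι ℂ H) (x : H) :
    basisConj b (basisConj b x) = x := by
  simp [basisConj]

theorem commutator_smul_add (X Y : H →L[ℂ] H) (a b c d : ℂ) :
    (a • X + c • 1) * (b • Y + d • 1) - (b • Y + d • 1) * (a • X + c • 1) =
      (a * b) • (X * Y - Y * X) := by
  simp only [add_mul, mul_add, smul_mul_assoc, mul_smul_comm, one_mul, mul_one]
  module

variable [CompleteSpace H]

theorem numericalRadius_basisTranspose {ι : Type*} (b : HilbertBasis ι ℂ H) (T : H →L[ℂ] H) :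
    numericalRadius (basisTranspose b T) = numericalRadius T := by
  refine numericalRadius_eq_of_equiv (basisConj b).toEquiv (fun x => (basisConj b).norm_map x)
    fun x => ?_
  change ‖⟪x, basisConj b (ContinuousLinearMap.adjoint T (basisConj b x))⟫_ℂ‖ =
    ‖⟪basisConj b x, T (basisConj b x)⟫_ℂ‖
  conv_lhs => rw [← basisConj_basisConj b x, inner_basisConj, basisConj_basisConj,
    ContinuousLinearMap.adjoint_inner_left]

theorem basisTranspose_apply {ι : Type*} (b : HilbertBasis ι ℂ H) {A : H →L[ℂ] H}
    (hA : IsSelfAdjoint A) (x : H) :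
    basisTranspose b A x = basisConj b (A (basisConj b x)) := by
  change basisConj b (ContinuousLinearMap.adjoint A (basisConj b x)) = _
  rw [hA.adjoint_eq]

theorem isSelfAdjoint_basisTranspose {ι : Type*} (b : HilbertBasis ι ℂ H) {A : H →L[ℂ] H}
    (hA : IsSelfAdjoint A) : IsSelfAdjoint (basisTranspose b A) := by
  rw [ContinuousLinearMap.isSelfAdjoint_iff_isSymmetric]
  intro x y
  change ⟪basisTranspose b A x, y⟫_ℂ = ⟪x, basisTranspose b A y⟫_ℂ
  rw [basisTranspose_apply b hA, basisTranspose_apply b hA]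
  conv_lhs => rw [← basisConj_basisConj b y, inner_basisConj]
  conv_rhs => rw [← basisConj_basisConj b x, inner_basisConj]
  rw [inner_apply_left_of_selfAdjoint hA]

theorem basisTranspose_commutator {ι : Type*} (b : HilbertBasis ι ℂ H) {A B : H →L[ℂ] H}
    (hA : IsSelfAdjoint A) (hB : IsSelfAdjoint B) :
    basisTranspose b A * basisTranspose b B - basisTranspose b B * basisTranspose b A =
      basisTranspose b (B * A - A * B) := by
  have hstar : ContinuousLinearMap.adjoint (B * A - A * B) = A * B - B * A := by
    rw [← ContinuousLinearMap.star_eq_adjoint, star_sub, star_mul, star_mul, hA.star_eq, hB.star_eq]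
  ext x
  change basisTranspose b A (basisTranspose b B x) - basisTranspose b B (basisTranspose b A x) =
    basisConj b (ContinuousLinearMap.adjoint (B * A - A * B) (basisConj b x))
  rw [hstar]
  simp only [basisTranspose_apply b hA, basisTranspose_apply b hB, basisConj_basisConj, sub_apply,
    mul_apply_eq_comp, map_sub]

theorem numericalRadius_unitary_conj {U : H →L[ℂ] H} (hU : U ∈ unitary (H →L[ℂ] H))
    (T : H →L[ℂ] H) : numericalRadius (U * T * star U) = numericalRadius T := by
  have h1 : ∀ x, U (star U x) = x := DFunLike.congr_fun (Unitary.mul_star_self_of_mem hU)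
  have h2 : ∀ x, star U (U x) = x := DFunLike.congr_fun (Unitary.star_mul_self_of_mem hU)
  refine numericalRadius_eq_of_equiv ⟨(star U : H →L[ℂ] H), U, h1, h2⟩ (fun x => ?_) fun x => ?_
  · exact ContinuousLinearMap.norm_map_of_mem_unitary (Unitary.star_mem hU) x
  · change ‖⟪x, U (T (star U x))⟫_ℂ‖ = ‖⟪star U x, T (star U x)⟫_ℂ‖
    rw [ContinuousLinearMap.star_eq_adjoint, ContinuousLinearMap.adjoint_inner_left]

theorem numericalRadius_commutator_conj {U : H →L[ℂ] H} (hU : U ∈ unitary (H →L[ℂ] H))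
    {X Y : H →L[ℂ] H} {a b : ℝ} (ha : a = 1 ∨ a = -1) (hb : b = 1 ∨ b = -1) (c d : ℂ) :
    numericalRadius (((a : ℂ) • (U * X * star U) + c • 1) * ((b : ℂ) • (U * Y * star U) + d • 1) -
        ((b : ℂ) • (U * Y * star U) + d • 1) * ((a : ℂ) • (U * X * star U) + c • 1)) =
      numericalRadius (X * Y - Y * X) := by
  have h1 : ∀ X Y : H →L[ℂ] H, U * X * star U * (U * Y * star U) = U * (X * Y) * star U := by
    intro X Y
    calc U * X * star U * (U * Y * star U) = U * X * (star U * U) * Y * star U := by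
          simp only [mul_assoc]
      _ = U * (X * Y) * star U := by
          rw [Unitary.star_mul_self_of_mem hU, mul_one]; simp only [mul_assoc]
  rw [commutator_smul_add, h1, h1, ← sub_mul, ← mul_sub, numericalRadius_smul,
    numericalRadius_unitary_conj hU]
  rcases ha with rfl | rfl <;> rcases hb with rfl | rfl <;> simp

theorem comm_iff_numericalRadius (A B : selfAdjoint (H →L[ℂ] H)) :
    Comm A B ↔
      numericalRadius
        ((A : H →L[ℂ] H) * (B : H →L[ℂ] H) - (B : H →L[ℂ] H) * (A : H →L[ℂ] H)) = 0 := by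
  rw [numericalRadius_eq_zero_iff, sub_eq_zero]
  rfl

/-- Rank one operators commute when their vectors are orthogonal or parallel, and the parallel case
is recognised by equal commutants. A third direction is essential: in dimension two, orthogonal
lines give equal commutants as well. -/
theorem inner_eq_zero_iff_comm
    (hdim : ∀ a b : H, ∃ c : H, c ≠ 0 ∧ ⟪a, c⟫_ℂ = 0 ∧ ⟪b, c⟫_ℂ = 0) {x y : H} (hx : x ≠ 0)
    (hy : y ≠ 0) : ⟪x, y⟫_ℂ = 0 ↔ Comm (rankOneSelf x) (rankOneSelf y) ∧
      ¬ CommutantLE Comm (rankOneSelf x) (rankOneSelf y) := by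
  constructor
  · intro h
    refine ⟨commute_of_apply_eq_smul (rankOneSelf x).2 (c := 0) (by simp [h]), fun hle => ?_⟩
    obtain ⟨z, hz, hxz, hyz⟩ := hdim x y
    have h1 := hle (rankTwoSwap y z)
      (commute_rankTwoSwap (c := 0) (rankOneSelf x).2 (by simp [h]) (by simp [hxz]))
    have h2 := DFunLike.congr_fun (show Commute _ _ from h1).eq y
    simp only [mul_apply_eq_comp, rankTwoSwap_apply, rankOneSelf_apply,
      inner_eq_zero_symm.mp hyz, zero_smul, zero_add, map_smul, hyz, smul_zero] at h2
    have := h2.symm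
    simp [hy, hz] at this
  · rintro ⟨h1, h2⟩
    by_contra h
    obtain ⟨c, hc⟩ := apply_eq_smul_of_commute h1
    rw [rankOneSelf_apply] at hc
    apply h2
    intro T hT
    have hxy : x = ((⟪x, y⟫_ℂ)⁻¹ * c) • y := by
      rw [mul_smul, ← hc, smul_smul, inv_mul_cancel₀ h, one_smul]
    have hd : ((‖(⟪x, y⟫_ℂ)⁻¹ * c‖ ^ 2 : ℝ) : ℂ) ≠ 0 := by
      have : (⟪x, y⟫_ℂ)⁻¹ * c ≠ 0 := fun h0 => hx (by rw [hxy, h0, zero_smul])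
      exact_mod_cast pow_ne_zero 2 (norm_ne_zero_iff.mpr this)
    refine (commute_of_coe_eq hd (b := 0) ?_ T).mpr hT
    rw [zero_smul, add_zero, ← rankOneSelf_smul, ← hxy]

theorem exists_smul_of_comm_iff
    (hdim : ∀ a b : H, ∃ c : H, c ≠ 0 ∧ ⟪a, c⟫_ℂ = 0 ∧ ⟪b, c⟫_ℂ = 0) {x y : H} (hx : x ≠ 0)
    (hy : y ≠ 0) (h : ∀ T, Comm (rankOneSelf x) T ↔ Comm (rankOneSelf y) T) :
    ∃ c : ℂ, y = c • x := by
  have h1 : Comm (rankOneSelf x) (rankOneSelf y) := (h _).mpr (Commute.refl _)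
  have h2 : ⟪x, y⟫_ℂ ≠ 0 := fun h0 =>
    ((inner_eq_zero_iff_comm hdim hx hy).mp h0).2 fun T hT => (h T).mp hT
  obtain ⟨c, hc⟩ := apply_eq_smul_of_commute h1
  rw [rankOneSelf_apply] at hc
  have hc0 : c ≠ 0 := by
    rintro rfl
    rw [zero_smul] at hc
    exact smul_ne_zero h2 hx hc
  exact ⟨c⁻¹ * ⟪x, y⟫_ℂ, by rw [mul_smul, hc, smul_smul, inv_mul_cancel₀ hc0, one_smul]⟩

theorem variance_rankOneSelf (y x : H) :
    variance (rankOneSelf y : H →L[ℂ] H) x =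
      ‖⟪y, x⟫_ℂ‖ ^ 2 * (‖y‖ ^ 2 * ‖x‖ ^ 2 - ‖⟪y, x⟫_ℂ‖ ^ 2) := by
  have h1 : ⟪x, ⟪y, x⟫_ℂ • y⟫_ℂ = ((‖⟪y, x⟫_ℂ‖ ^ 2 : ℝ) : ℂ) := by
    rw [inner_smul_right, ← inner_conj_symm x y, Complex.mul_conj, Complex.normSq_eq_norm_sq]
  rw [variance, rankOneSelf_apply, h1, norm_smul, Complex.ofReal_re]
  ring

theorem variance_smul_add {A B : H →L[ℂ] H} (hB : IsSelfAdjoint B) (hA : IsSelfAdjoint A)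
    {a b : ℝ} (h : A = (a : ℂ) • B + (b : ℂ) • 1) (x : H) :
    variance A x = a ^ 2 * variance B x := by
  rw [← numericalRadius_commutator_rankOneSelf hA, ← numericalRadius_commutator_rankOneSelf hB]
  have := commutator_smul_add B (rankOneSelf x : H →L[ℂ] H) a 1 b 0
  rw [zero_smul, one_smul, add_zero, mul_one, ← h] at this
  rw [this, numericalRadius_smul, mul_pow, Complex.norm_real, Real.norm_eq_abs, sq_abs]

/-- The vectors `x`, `x + e` and `x + 2e` are pairwise neither orthogonal nor parallel. -/
theorem variance_rankOneSelf_pos {x e : H} (hx : x ≠ 0) (he : e ≠ 0) (hxe : ⟪x, e⟫_ℂ = 0) :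
    variance (rankOneSelf x : H →L[ℂ] H) (x + e) ≠ 0 ∧
    variance (rankOneSelf x : H →L[ℂ] H) (x + (2 : ℂ) • e) ≠ 0 ∧
    variance (rankOneSelf (x + e) : H →L[ℂ] H) (x + (2 : ℂ) • e) ≠ 0 := by
  have hex := inner_eq_zero_symm.mp hxe
  have ha : 0 < ‖x‖ ^ 2 := by have := norm_pos_iff.mpr hx; positivity
  have hb : 0 < ‖e‖ ^ 2 := by have := norm_pos_iff.mpr he; positivity
  set a : ℝ := ‖x‖ ^ 2 with hadef
  set b : ℝ := ‖e‖ ^ 2 with hbdef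
  have hxx : ⟪x, x⟫_ℂ = (a : ℂ) := by rw [inner_self_eq_norm_sq_to_K, hadef]; simp
  have hee : ⟪e, e⟫_ℂ = (b : ℂ) := by rw [inner_self_eq_norm_sq_to_K, hbdef]; simp
  have i0 : ∀ s t : ℝ, ⟪x + (s : ℂ) • e, x + (t : ℂ) • e⟫_ℂ = ((a + s * t * b : ℝ) : ℂ) := by
    intro s t
    simp only [inner_add_left, inner_add_right, inner_smul_left, inner_smul_right, hxe, hex, hxx,
      hee, Complex.conj_ofReal, Complex.ofReal_add, Complex.ofReal_mul]
    ring
  have i1 : ⟪x, x + e⟫_ℂ = (a : ℂ) := by simpa only [Complex.ofReal_zero, zero_smul, add_zero,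
    Complex.ofReal_one, one_smul, zero_mul] using i0 0 1
  have i2 : ⟪x, x + (2 : ℂ) • e⟫_ℂ = (a : ℂ) := by simpa only [Complex.ofReal_zero, zero_smul,
    add_zero, Complex.ofReal_ofNat, zero_mul] using i0 0 2
  have i3 : ⟪x + e, x + (2 : ℂ) • e⟫_ℂ = ((a + 2 * b : ℝ) : ℂ) := by
    simpa only [Complex.ofReal_one, one_smul, Complex.ofReal_ofNat, one_mul] using i0 1 2
  have n1 : ‖x + e‖ ^ 2 = a + b := norm_sq_eq_of_inner_self (by
    simpa only [Complex.ofReal_one, one_smul, one_mul] using i0 1 1)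
  have n2 : ‖x + (2 : ℂ) • e‖ ^ 2 = a + 4 * b := norm_sq_eq_of_inner_self (by
    have := i0 2 2
    norm_num only at this
    simpa only [Complex.ofReal_ofNat] using this)
  rw [variance_rankOneSelf, variance_rankOneSelf, variance_rankOneSelf, n1, n2, i1, i2, i3,
    ← hadef, Complex.norm_real, Complex.norm_real, Real.norm_eq_abs, Real.norm_eq_abs, sq_abs,
    sq_abs]
  refine ⟨ne_of_gt ?_, ne_of_gt ?_, ne_of_gt ?_⟩
  · rw [show a ^ 2 * (a * (a + b) - a ^ 2) = a ^ 2 * (a * b) by ring]; positivity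
  · rw [show a ^ 2 * (a * (a + 4 * b) - a ^ 2) = a ^ 2 * (4 * (a * b)) by ring]; positivity
  · rw [show (a + 2 * b) ^ 2 * ((a + b) * (a + 4 * b) - (a + 2 * b) ^ 2) =
      (a + 2 * b) ^ 2 * (a * b) by ring]
    positivity

theorem eq_unitary_conj_of_variance (V : H ≃ₗᵢ[ℂ] H) {B C : H →L[ℂ] H} (hB : IsSelfAdjoint B)
    (hC : IsSelfAdjoint C) (h : ∀ x, variance B x = variance C (V x)) :
    ∃ s f : ℝ, (s = 1 ∨ s = -1) ∧ C = (s : ℂ) •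
      ((Unitary.linearIsometryEquiv.symm V : H →L[ℂ] H) * B *
        star (Unitary.linearIsometryEquiv.symm V : H →L[ℂ] H)) + (f : ℂ) • (1 : H →L[ℂ] H) := by
  set U : H →L[ℂ] H := (Unitary.linearIsometryEquiv.symm V : H →L[ℂ] H) with hUdef
  have hU : U ∈ unitary (H →L[ℂ] H) := (Unitary.linearIsometryEquiv.symm V).2
  have hUV : ∀ x, U x = V x := fun x => rfl
  have h1 := Unitary.mul_star_self_of_mem hU
  -- Pulling `C` back by `U` makes the variances comparable at the same vector.
  obtain ⟨s, f, hs, hsf⟩ := eq_smul_add_of_variance (A := B) (B := star U * C * U) hB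
    (hC.conjugate' U) fun x => by
      rw [h, variance, variance, ← hUV]
      change _ = ‖star U (C (U x))‖ ^ 2 * _ - (⟪x, star U (C (U x))⟫_ℂ).re ^ 2
      rw [ContinuousLinearMap.norm_map_of_mem_unitary (Unitary.star_mem hU),
        ContinuousLinearMap.norm_map_of_mem_unitary hU, ContinuousLinearMap.star_eq_adjoint,
        ContinuousLinearMap.adjoint_inner_right]
  refine ⟨s, f, hs, ?_⟩
  calc C = (U * star U) * C * (U * star U) := by rw [h1, one_mul, mul_one]
    _ = U * (star U * C * U) * star U := by simp only [mul_assoc]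
    _ = _ := by
      rw [hsf, mul_add, add_mul, mul_smul_comm, smul_mul_assoc, mul_smul_comm, mul_one,
        smul_mul_assoc, h1]

/-- A surjection that preserves the numerical radius of commutators is induced, on rank one
operators, by a unitary or antiunitary map, and this map transports variances. -/
theorem exists_semilinear_variance
    (hdim : ∀ a b : H, ∃ c : H, c ≠ 0 ∧ ⟪a, c⟫_ℂ = 0 ∧ ⟪b, c⟫_ℂ = 0)
    {Φ : selfAdjoint (H →L[ℂ] H) → selfAdjoint (H →L[ℂ] H)} (hΦ : Function.Surjective Φ)
    (h : ∀ A B : selfAdjoint (H →L[ℂ] H),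
      numericalRadius ((A : H →L[ℂ] H) * (B : H →L[ℂ] H) - (B : H →L[ℂ] H) * (A : H →L[ℂ] H)) =
        numericalRadius
          ((Φ A : H →L[ℂ] H) * (Φ B : H →L[ℂ] H) - (Φ B : H →L[ℂ] H) * (Φ A : H →L[ℂ] H))) :
    ∃ (σ : ℂ →+* ℂ) (S : H → H), (σ = RingHom.id ℂ ∨ σ = starRingEnd ℂ) ∧
      (∀ x y, S (x + y) = S x + S y) ∧ (∀ (c : ℂ) (x : H), S (c • x) = σ c • S x) ∧
      (∀ x y, ⟪S x, S y⟫_ℂ = σ ⟪x, y⟫_ℂ) ∧ Function.Surjective S ∧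
      ∀ (A : selfAdjoint (H →L[ℂ] H)) (x : H),
        variance (A : H →L[ℂ] H) x = variance (Φ A : H →L[ℂ] H) (S x) := by
  have hcomm : ∀ A B, Comm A B ↔ Comm (Φ A) (Φ B) := fun A B => by
    rw [comm_iff_numericalRadius, comm_iff_numericalRadius, h]
  -- The zero vector receives dummy values, so that `choose` gives total functions.
  have hex : ∀ x : H, ∃ (y : H) (a b : ℝ), x ≠ 0 → y ≠ 0 ∧ a ≠ 0 ∧
      (Φ (rankOneSelf x) : H →L[ℂ] H) =
        (a : ℂ) • (rankOneSelf y : H →L[ℂ] H) + (b : ℂ) • 1 := fun x => by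
    by_cases hx : x = 0
    · exact ⟨0, 0, 0, fun h => absurd hx h⟩
    · obtain ⟨y, a, b, hy⟩ := IsAtomic.exists_rankOneSelf
        ((isAtomic_map_iff hΦ hcomm _).mpr (isAtomic_rankOneSelf hdim hx))
      exact ⟨y, a, b, fun _ => hy⟩
  choose p α β hp using hex
  have hpc : ∀ x, x ≠ 0 → ∀ T, Comm (rankOneSelf (p x)) T ↔ Comm (Φ (rankOneSelf x)) T :=
    fun x hx => commute_of_coe_eq (by exact_mod_cast (hp x hx).2.1) (hp x hx).2.2
  have hortho : IsOrthoMap p := by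
    refine ⟨fun x hx => (hp x hx).1, fun x y hx hy => ?_, fun y hy => ?_⟩
    · rw [inner_eq_zero_iff_comm hdim hx hy,
        inner_eq_zero_iff_comm hdim (hp x hx).1 (hp y hy).1]
      have e1 : Comm (rankOneSelf (p x)) (rankOneSelf (p y)) ↔
          Comm (rankOneSelf x) (rankOneSelf y) := by
        rw [hpc x hx, hcomm (rankOneSelf x)]
        constructor
        · intro h1
          exact Commute.symm ((hpc y hy _).mp (Commute.symm h1))
        · intro h1
          exact Commute.symm ((hpc y hy _).mpr (Commute.symm h1))
      have e2 : CommutantLE Comm (rankOneSelf (p x)) (rankOneSelf (p y)) ↔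
          CommutantLE Comm (rankOneSelf x) (rankOneSelf y) := by
        constructor
        · intro h1 T hT
          exact (hcomm _ _).mpr ((hpc y hy _).mp (h1 _ ((hpc x hx _).mpr ((hcomm _ _).mp hT))))
        · intro h1 T hT
          obtain ⟨T, rfl⟩ := hΦ T
          exact (hpc y hy _).mpr ((hcomm _ _).mp (h1 T ((hcomm _ _).mpr ((hpc x hx _).mp hT))))
      rw [e1, e2]
    · obtain ⟨A, hA⟩ := hΦ (rankOneSelf y)
      have hat : IsAtomic Comm A := by
        rw [← isAtomic_map_iff hΦ hcomm, hA]
        exact isAtomic_rankOneSelf hdim hy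
      obtain ⟨x, a, b, hx, ha, hAx⟩ := hat.exists_rankOneSelf
      refine ⟨x, hx, exists_smul_of_comm_iff hdim (hp x hx).1 hy fun T => ?_⟩
      obtain ⟨T, rfl⟩ := hΦ T
      rw [hpc x hx, ← hcomm, ← hA, ← hcomm]
      exact commute_of_coe_eq (by exact_mod_cast ha) hAx T
  obtain ⟨σ, S, hσ, hadd, hsmul, hinner, hsurj, hpS⟩ := hortho.exists_semilinear hdim
  have hσn : ∀ c, ‖σ c‖ = ‖c‖ := by
    rcases hσ with rfl | rfl <;> simp
  have hSn : ∀ x, ‖S x‖ ^ 2 = ‖x‖ ^ 2 := fun x => norm_sq_eq_of_inner_self (by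
    rw [hinner, inner_self_eq_norm_sq_to_K]
    rcases hσ with rfl | rfl <;> simp)
  have hγ : ∀ x : H, ∃ γ δ : ℝ, x ≠ 0 → (Φ (rankOneSelf x) : H →L[ℂ] H) =
      (γ : ℂ) • (rankOneSelf (S x) : H →L[ℂ] H) + (δ : ℂ) • 1 := fun x => by
    by_cases hx : x = 0
    · exact ⟨0, 0, fun h => absurd hx h⟩
    obtain ⟨c, hc⟩ := hpS x hx
    refine ⟨α x * ‖c‖ ^ 2, β x, fun _ => ?_⟩
    rw [(hp x hx).2.2, hc, rankOneSelf_smul, smul_smul, Complex.ofReal_mul]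
  choose γ δ hγ using hγ
  have hvar : ∀ (A : selfAdjoint (H →L[ℂ] H)) (x : H), x ≠ 0 →
      variance (A : H →L[ℂ] H) x = γ x ^ 2 * variance (Φ A : H →L[ℂ] H) (S x) := by
    intro A x hx
    rw [← numericalRadius_commutator_rankOneSelf A.2, h, hγ x hx,
      ← numericalRadius_commutator_rankOneSelf (Φ A).2]
    have := commutator_smul_add (Φ A : H →L[ℂ] H) (rankOneSelf (S x) : H →L[ℂ] H) 1 (γ x) 0 (δ x)
    rw [zero_smul, one_smul, add_zero, one_mul] at this
    rw [this, numericalRadius_smul, mul_pow, Complex.norm_real, Real.norm_eq_abs, sq_abs]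
  -- Passing from `x ⊗ x` to its image multiplies the variance by `γ x ^ 2`, and testing at `y` by
  -- `γ y ^ 2`. As `S` preserves the variances of rank one operators, the product is 1 wherever the
  -- variance is nonzero.
  have hγγ : ∀ x y : H, x ≠ 0 → y ≠ 0 → variance (rankOneSelf x : H →L[ℂ] H) y ≠ 0 →
      γ x ^ 2 * γ y ^ 2 = 1 := by
    intro x y hx hy hxy
    have h1 := hvar (rankOneSelf x) y hy
    rw [variance_smul_add (rankOneSelf (S x)).2 (Φ (rankOneSelf x)).2 (hγ x hx),
      variance_rankOneSelf (S x), hinner, hσn, hSn, hSn, ← variance_rankOneSelf] at h1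
    refine mul_right_cancel₀ hxy ?_
    rw [one_mul]
    linear_combination -h1
  refine ⟨σ, S, hσ, hadd, hsmul, hinner, hsurj, fun A x => ?_⟩
  by_cases hx : x = 0
  · have hS0 : S 0 = 0 := by simpa using hadd 0 0
    simp [hx, hS0, variance]
  obtain ⟨e, he, hxe, -⟩ := hdim x x
  obtain ⟨v1, v2, v3⟩ := variance_rankOneSelf_pos hx he hxe
  have hne : ∀ c : ℂ, x + c • e ≠ 0 := fun c h0 => by
    have h1 : ⟪x, x + c • e⟫_ℂ = 0 := by rw [h0, inner_zero_right]
    rw [inner_add_right, inner_smul_right, hxe, mul_zero, add_zero, inner_self_eq_zero] at h1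
    exact hx h1
  have hne1 : x + e ≠ 0 := by simpa using hne 1
  have g1 := hγγ _ _ hx hne1 v1
  have g2 := hγγ _ _ hx (hne 2) v2
  have g3 := hγγ _ _ hne1 (hne 2) v3
  -- Of the three pairwise products equal to 1, multiply the two involving `x` and cancel the third.
  have h4 : (γ x ^ 2) ^ 2 = 1 := by
    linear_combination g1 * γ x ^ 2 * γ (x + (2 : ℂ) • e) ^ 2 + g2 - (γ x ^ 2) ^ 2 * g3
  have h5 : γ x ^ 2 = 1 := (pow_eq_one_iff_of_nonneg (sq_nonneg _) two_ne_zero).mp h4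
  rw [hvar A x hx, h5, one_mul]

end Main

end LieNumRadius

end

/-! ### The characterisation -/

theorem theorem2p1 {H : Type*} [NormedAddCommGroup H] [InnerProductSpace ℂ H] [CompleteSpace H]
    [TopologicalSpace.SeparableSpace H] (hdim : 3 ≤ Module.rank ℂ H)
    {ι : Type*} (b : HilbertBasis ι ℂ H)
    (Φ : selfAdjoint (H →L[ℂ] H) → selfAdjoint (H →L[ℂ] H)) (hΦ : Function.Surjective Φ) :
    (∀ A B : selfAdjoint (H →L[ℂ] H),
      LieNumRadius.numericalRadius
          ((A : H →L[ℂ] H) * (B : H →L[ℂ] H) - (B : H →L[ℂ] H) * (A : H →L[ℂ] H)) =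
        LieNumRadius.numericalRadius
          ((Φ A : H →L[ℂ] H) * (Φ B : H →L[ℂ] H) - (Φ B : H →L[ℂ] H) * (Φ A : H →L[ℂ] H))) ↔
    ∃ U ∈ unitary (H →L[ℂ] H), ∃ h : selfAdjoint (H →L[ℂ] H) → ℝ,
      ∃ f : selfAdjoint (H →L[ℂ] H) → ℝ,
        (∀ T, h T = 1 ∨ h T = -1) ∧
        ((∀ T : selfAdjoint (H →L[ℂ] H),
            (Φ T : H →L[ℂ] H) =
              (h T : ℂ) • (U * (T : H →L[ℂ] H) * star U) + (f T : ℂ) • (1 : H →L[ℂ] H)) ∨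
          (∀ T : selfAdjoint (H →L[ℂ] H),
            (Φ T : H →L[ℂ] H) =
              (h T : ℂ) • (U * LieNumRadius.basisTranspose b (T : H →L[ℂ] H) * star U) +
                (f T : ℂ) • (1 : H →L[ℂ] H))) := by
  open LieNumRadius in
  constructor
  · intro h
    obtain ⟨σ, S, hσ, hadd, hsmul, hinner, hsurj, hvar⟩ :=
      exists_semilinear_variance (exists_orthogonal_pair hdim) hΦ h
    rcases hσ with rfl | rfl
    · let L : H →ₗ[ℂ] H := { toFun := S, map_add' := hadd, map_smul' := hsmul }
      let V : H ≃ₗᵢ[ℂ] H := LinearIsometryEquiv.ofSurjective (L.isometryOfInner hinner) hsurj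
      choose s f hs hsf using fun T : selfAdjoint (H →L[ℂ] H) =>
        eq_unitary_conj_of_variance V T.2 (Φ T).2 (hvar T)
      exact ⟨_, (Unitary.linearIsometryEquiv.symm V).2, s, f, hs, Or.inl hsf⟩
    -- Antiunitary case: `S ∘ J` is linear, and the variance of the transpose at `x` is that of `T`
    -- at `J x`.
    · let J := basisConj b
      let L : H →ₗ[ℂ] H :=
        { toFun := fun x => S (J x)
          map_add' := fun x y => by rw [map_add, hadd]
          map_smul' := fun c x => by
            rw [J.map_smulₛₗ, hsmul, Complex.conj_conj, RingHom.id_apply] }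
      have hL : ∀ x y, ⟪L x, L y⟫_ℂ = ⟪x, y⟫_ℂ := fun x y => by
        change ⟪S (J x), S (J y)⟫_ℂ = _
        rw [hinner, inner_basisConj, inner_conj_symm]
      let V : H ≃ₗᵢ[ℂ] H := LinearIsometryEquiv.ofSurjective (L.isometryOfInner hL)
        (hsurj.comp J.surjective)
      have hV : ∀ (T : selfAdjoint (H →L[ℂ] H)) (x : H),
          variance (basisTranspose b (T : H →L[ℂ] H)) x = variance (Φ T : H →L[ℂ] H) (V x) := by
        intro T x
        change _ = variance (Φ T : H →L[ℂ] H) (S (J x))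
        rw [← hvar, variance, variance, basisTranspose_apply b T.2, LinearIsometryEquiv.norm_map,
          LinearIsometryEquiv.norm_map]
        congr 3
        conv_lhs => rw [← basisConj_basisConj b x, inner_basisConj, basisConj_basisConj,
          inner_apply_left_of_selfAdjoint T.2]
      choose s f hs hsf using fun T : selfAdjoint (H →L[ℂ] H) =>
        eq_unitary_conj_of_variance V (isSelfAdjoint_basisTranspose b T.2) (Φ T).2 (hV T)
      exact ⟨_, (Unitary.linearIsometryEquiv.symm V).2, s, f, hs, Or.inr hsf⟩
  · rintro ⟨U, hU, s, f, hs, h | h⟩ A B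
    · rw [h A, h B, numericalRadius_commutator_conj hU (hs A) (hs B)]
    · rw [h A, h B, numericalRadius_commutator_conj hU (hs A) (hs B),
        -- Transposition reverses products, so the commutator appears with the opposite sign, which
        -- the numerical radius ignores.
        basisTranspose_commutator b A.2 B.2, numericalRadius_basisTranspose,
        ← neg_sub, ← neg_one_smul ℂ, numericalRadius_smul, norm_neg, norm_one, one_mul]
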